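/- **Conventions.** For a real $\delta>0$ and a positive definite $p\times p$ matrix $D$, $\mathrm{IW}_p(\delta,D)$ is the probability distribution on positive definite $p\times p$ matrices with density proportional to $|X|^{-(\delta+2p)/2}\exp\{-\tfrac12\operatorname{tr}(DX^{-1})\}$ (so its mean is $D/(\delta-2)$ if $\delta>2$). $N(M,U,V)$ is the matrix normal distribution with mean $M$, row covariance $U$ and column covariance $V$. Let $n>0$ and let $S,F$ be $q\times q$ matrices with $S$ and $S-FSF'$ positive definite. A sequence $(\Sigma_t)_{t\ge 0}$ of random $q\times q$ matrices is an *IW-AR(1) process* with parameters $(n,S,F)$ if it is a first-order Markov process in which every pair $(\Sigma_{t-1},\Sigma_t)$, $t\ge1$, is distributed as the two diagonal blocks of $$\begin{pmatrix}\Sigma_{t-1}&\phi_t'\\ \phi_t&\Sigma_t\end{pmatrix}\sim \mathrm{IW}_{2q}\!\left(n+2,\;n\begin{pmatrix}S&SF'\\ FS&S\end{pmatrix}\right).$$ Random matrices $(\phi_t)_{t\ge1}$ are *latent blocks* of the process if the displayed matrix has this law for every $t\ge 1$ and, given $\Sigma_{t-1}$, the pair $(\phi_t,\Sigma_t)$ is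 conditionally independent of $(\Sigma_0,\dots,\Sigma_{t-1},\phi_1,\dots,\phi_{t-1})$. Its *innovations* are then $\Upsilon_t=\phi_t\Sigma_{t-1}^{-1}$ and $\Psi_t=\Sigma_t-\Upsilon_t\Sigma_{t-1}\Upsilon_t'$. **Theorem.** Let $(\Sigma_t)$ be an IW-AR(1) process with parameters $(n,S,F)$, where $F=ERE'$ and $S=EQE'$ with $E$ orthogonal, $R=\operatorname{diag}(\rho_1,\dots,\rho_q)$ and $Q=\operatorname{diag}(\xi_1,\dots,\xi_q)$, $\xi_i>0$. Put $\hat\Sigma_t=E'\Sigma_tE$ and $c_{n,q}=n/(n+q)$. Then: 1. $(\hat\Sigma_t)$ is an IW-AR(1) process with parameters $(n,Q,R)$ (degrees of freedom $n$, scale matrix $Q$, AR matrix $R$), and $\hat\Sigma_t\sim \mathrm{IW}_q(n+2,nQ)$ for every $t\ge 0$. 2. If $(\phi_t)$ are latent blocks of $(\Sigma_t)$, with innovations $(\Upsilon_t,\Psi_t)$, then $\hat\phi_t=E'\phi_tE$ are latent blocks of $(\hat\Sigma_t)$, and $\hat\Upsilon_t=E'\Upsilon_tE$, $\hat\Psi_t=E'\Psi_tE$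 satisfy, for every $t\ge1$: $\hat\phi_t=\hat\Upsilon_t\hat\Sigma_{t-1}$ almost surely, $$\hat\Sigma_t=\hat\Psi_t+\hat\Upsilon_t\hat\Sigma_{t-1}\hat\Upsilon_t',\qquad \hat\Psi_t\sim \mathrm{IW}_q\big(n+q+2,\;nQ(I-R^2)\big),\qquad \hat\Upsilon_t\mid\hat\Psi_t\sim N\big(R,\hat\Psi_t,(nQ)^{-1}\big),$$ and $(\hat\Upsilon_t,\hat\Psi_t)$ is independent of $(\hat\Sigma_0,\dots,\hat\Sigma_{t-1},\hat\phi_1,\dots,\hat\phi_{t-1})$. 3. For every $t\ge 1$ the entries of $\hat\Sigma_t$ are integrable and $$E[\hat\Sigma_t\mid\hat\Sigma_{t-1}]=R\hat\Sigma_{t-1}R+c_{n,q}\Big[1+\sum_i (n\xi_i)^{-1}\hat\Sigma_{t-1,ii}\Big]Q(I-R^2).$$ 4. There are integrable noise variables $v_{t,ij}$ ($t\ge1$) with mean zero, and with conditional mean zero given $\hat\Sigma_0,\dots,\hat\Sigma_{t-1}$, such that for all $j$ $$\hat\Sigma_{t,jj}=\rho_j^2\hat\Sigma_{t-1,jj}+c_{n,q}\Big[1+\sum_i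 (n\xi_i)^{-1}\hat\Sigma_{t-1,ii}\Big](1-\rho_j^2)\xi_j+v_{t,jj},$$ and $\hat\Sigma_{t,ij}=\rho_i\rho_j\hat\Sigma_{t-1,ij}+v_{t,ij}$ for $i\ne j$. -/

import Mathlib

open MeasureTheory ProbabilityTheory Matrix

noncomputable section

/-! ### Matrices as a measurable space -/

/-- The product (equivalently, Borel) sigma-algebra on real matrices. -/
instance instMeasurableSpaceMatrix {m k : Type*} : MeasurableSpace (Matrix m k ℝ) :=
  inferInstanceAs (MeasurableSpace (m → k → ℝ))

instance instStandardBorelSpaceMatrix {m k : Type*} [Countable m] [Countable k] :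
    StandardBorelSpace (Matrix m k ℝ) :=
  inferInstanceAs (StandardBorelSpace (m → k → ℝ))

/-- Lebesgue measure on the space of all `m × k` real matrices. -/
def matrixLebesgue (m k : Type*) [Fintype m] [Fintype k] : Measure (Matrix m k ℝ) :=
  (volume : Measure (m → k → ℝ)).map Matrix.of

/-- Lebesgue measure on the space of symmetric `ι × ι` real matrices (the product of the Lebesgue
measures of the entries `X i j`, one for each unordered pair of indices), seen as a measure on all
matrices. -/
def symmLebesgue (ι : Type*) [Fintype ι] [DecidableEq ι] : Measure (Matrix ι ι ℝ) :=
  (volume : Measure (Sym2 ι → ℝ)).map fun x => Matrix.of fun i j => x s(i, j)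

/-! ### The inverse Wishart and the matrix normal distribution -/

/-- The measure on positive definite `p × p` matrices with density
`|X|^{-(δ + 2p)/2} exp(-tr(D X⁻¹)/2)` with respect to Lebesgue measure on symmetric matrices. -/
def inverseWishartUnnormalized {ι : Type*} [Fintype ι] [DecidableEq ι]
    (δ : ℝ) (D : Matrix ι ι ℝ) : Measure (Matrix ι ι ℝ) :=
  (symmLebesgue ι).withDensity
    ({X : Matrix ι ι ℝ | X.PosDef}.indicator fun X =>
      ENNReal.ofReal (X.det ^ (-(δ + 2 * (Fintype.card ι : ℝ)) / 2) *
        Real.exp (-(D * X⁻¹).trace / 2)))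

/-- The inverse Wishart distribution `IW(δ, D)` with `δ > 0` degrees of freedom and positive
definite scale matrix `D`, in the parameterization whose marginal on a principal block has the same
`δ` (so the mean is `D / (δ - 2)` for `δ > 2`, and for `1 × 1` matrices it is the inverse gamma
distribution with shape `δ / 2` and scale `D / 2`): the probability measure proportional to
`|X|^{-(δ + 2p)/2} exp(-tr(D X⁻¹)/2)` on positive definite `p × p` matrices. -/
def inverseWishart {ι : Type*} [Fintype ι] [DecidableEq ι]
    (δ : ℝ) (D : Matrix ι ι ℝ) : Measure (Matrix ι ι ℝ) :=
  (inverseWishartUnnormalized δ D Set.univ)⁻¹ • inverseWishartUnnormalized δ D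

/-- The matrix normal distribution `N(M, U, V)` on `m × k` matrices with mean `M`, row covariance
`U` (`m × m`) and column covariance `V` (`k × k`), both positive definite, so that
`Cov (X i a) (X j b) = U i j * V a b`. -/
def matrixNormal {m k : Type*} [Fintype m] [DecidableEq m] [Fintype k] [DecidableEq k]
    (M : Matrix m k ℝ) (U : Matrix m m ℝ) (V : Matrix k k ℝ) : Measure (Matrix m k ℝ) :=
  (matrixLebesgue m k).withDensity fun X =>
    ENNReal.ofReal
      ((2 * Real.pi) ^ (-((Fintype.card m : ℝ) * (Fintype.card k : ℝ)) / 2) *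
        U.det ^ (-(Fintype.card k : ℝ) / 2) * V.det ^ (-(Fintype.card m : ℝ) / 2) *
        Real.exp (-(V⁻¹ * (X - M)ᵀ * U⁻¹ * (X - M)).trace / 2))

/-! ### The IW-AR(1) process -/

/-- The sigma-algebra generated by `X 0, …, X t`. -/
abbrev pastOf {Ω α : Type*} [MeasurableSpace α] (X : ℕ → Ω → α) (t : ℕ) : MeasurableSpace Ω :=
  ⨆ s : Fin (t + 1), MeasurableSpace.comap (X (s : ℕ)) inferInstance

/-- The sigma-algebra generated by `X 0, …, X t` and `φ 1, …, φ t`. -/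
abbrev pastOfAugmented {Ω α β : Type*} [MeasurableSpace α] [MeasurableSpace β]
    (X : ℕ → Ω → α) (φ : ℕ → Ω → β) (t : ℕ) : MeasurableSpace Ω :=
  pastOf X t ⊔ ⨆ s : Fin t, MeasurableSpace.comap (φ ((s : ℕ) + 1)) inferInstance

/-- The `2q × 2q` matrix with blocks `S`, `S F'`, `F S`, `S`. -/
def iwarScale {q : ℕ} (S F : Matrix (Fin q) (Fin q) ℝ) :
    Matrix (Fin q ⊕ Fin q) (Fin q ⊕ Fin q) ℝ :=
  Matrix.fromBlocks S (S * Fᵀ) (F * S) S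

/-- `X 0, X 1, …` is an IW-AR(1) process with degrees of freedom `n`, scale matrix `S` and AR matrix
`F`: a first-order Markov process such that each pair `(X t, X (t + 1))` is distributed as the two
diagonal blocks of an `IW(n + 2, n [S, S F'; F S, S])` matrix. The parameters are valid when `n > 0`
and `S`, `S - F S F'` are positive definite, that is, the `2q × 2q` scale is positive definite. -/
structure IsIWAR {Ω : Type*} [MeasurableSpace Ω] (μ : Measure Ω) {q : ℕ}
    (n : ℝ) (S F : Matrix (Fin q) (Fin q) ℝ) (X : ℕ → Ω → Matrix (Fin q) (Fin q) ℝ) : Prop where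
  n_pos : 0 < n
  posDef_scale : S.PosDef
  posDef_innovation : (S - F * S * Fᵀ).PosDef
  measurable : ∀ t, Measurable (X t)
  law_pair : ∀ t, HasLaw (fun ω => (X t ω, X (t + 1) ω))
    ((inverseWishart (n + 2) (n • iwarScale S F)).map fun Z => (Z.toBlocks₁₁, Z.toBlocks₂₂)) μ
  markov : ∀ t, ∀ B : Set (Matrix (Fin q) (Fin q) ℝ), MeasurableSet B →
    μ⟦X (t + 1) ⁻¹' B | pastOf X t⟧ =ᵐ[μ]
      μ⟦X (t + 1) ⁻¹' B | MeasurableSpace.comap (X t) inferInstance⟧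

/-- The IW-AR(1) process `X` together with its latent off-diagonal blocks `φ 1, φ 2, …` (`φ 0` plays
no role): the matrix with blocks `X t`, `φ (t + 1)'`, `φ (t + 1)`, `X (t + 1)` is
`IW(n + 2, n [S, S F'; F S, S])`, and given `X t` the pair `(φ (t + 1), X (t + 1))` does not depend
further on the past `X 0, …, X t, φ 1, …, φ t`. -/
structure IsAugmentedIWAR {Ω : Type*} [MeasurableSpace Ω] (μ : Measure Ω) {q : ℕ}
    (n : ℝ) (S F : Matrix (Fin q) (Fin q) ℝ) (X φ : ℕ → Ω → Matrix (Fin q) (Fin q) ℝ) : Prop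
    extends IsIWAR μ n S F X where
  measurable_latent : ∀ t, Measurable (φ (t + 1))
  law_block : ∀ t, HasLaw
    (fun ω => Matrix.fromBlocks (X t ω) (φ (t + 1) ω)ᵀ (φ (t + 1) ω) (X (t + 1) ω))
    (inverseWishart (n + 2) (n • iwarScale S F)) μ
  markov_augmented : ∀ t,
    ∀ B : Set (Matrix (Fin q) (Fin q) ℝ × Matrix (Fin q) (Fin q) ℝ), MeasurableSet B →
    μ⟦(fun ω => (φ (t + 1) ω, X (t + 1) ω)) ⁻¹' B | pastOfAugmented X φ t⟧ =ᵐ[μ]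
      μ⟦(fun ω => (φ (t + 1) ω, X (t + 1) ω)) ⁻¹' B | MeasurableSpace.comap (X t) inferInstance⟧

/-- The innovation `Υ_{t+1} = φ_{t+1} X_t⁻¹`. -/
def innovΥ {Ω : Type*} {q : ℕ} (X φ : ℕ → Ω → Matrix (Fin q) (Fin q) ℝ) (t : ℕ) (ω : Ω) :
    Matrix (Fin q) (Fin q) ℝ :=
  φ (t + 1) ω * (X t ω)⁻¹

/-- The innovation `Ψ_{t+1} = X_{t+1} - Υ_{t+1} X_t Υ_{t+1}'`. -/
def innovΨ {Ω : Type*} {q : ℕ} (X φ : ℕ → Ω → Matrix (Fin q) (Fin q) ℝ) (t : ℕ) (ω : Ω) :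
    Matrix (Fin q) (Fin q) ℝ :=
  X (t + 1) ω - innovΥ X φ t ω * X t ω * (innovΥ X φ t ω)ᵀ

/-- The sequence `E' X_t E`. -/
def rotate {Ω : Type*} {q : ℕ} (E : Matrix (Fin q) (Fin q) ℝ)
    (X : ℕ → Ω → Matrix (Fin q) (Fin q) ℝ) (t : ℕ) (ω : Ω) : Matrix (Fin q) (Fin q) ℝ :=
  Eᵀ * X t ω * E

end

/-! Reduction to diagonal parameters. A congruence X ↦ TXT' with T orthogonal preserves Lebesgue
measure on symmetric matrices, positive definiteness and the determinant, and the trace of DX⁻¹ is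
unchanged when D moves along with X. Hence it carries IW(δ, D) to IW(δ, TDT')
(`map_congruence_inverseWishart`). For T = diag(E', E') this turns the pair law with parameters (S,
F) into the one with (Q, R). Rotation is moreover a measurable bijection, so it changes none of the
sigma-algebras in the Markov conditions (`comap_rotate`), and innovations rotate along with the
process.

Innovations. A symmetric block matrix with upper left block A is parametrised by A, the regression
matrix Y = BA⁻¹ and the Schur complement P. The Jacobian is a power of |A|, the determinant is
|A||P|, and completing the square splits the trace. The inverse Wishart density therefore factors
into an inverse Wishart density in A, another one in P, and a matrix normal density in Y given P
(`inverseWishart_fromBlocks`). For the IW-AR(1) scale, P and Y are the innovations Ψ and Υ,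
independent of the old state; the Markov property extends this to independence of the whole past
(`map_restrict_innovation`). Beyond 1 × 1 matrices no normalising constant is computed: finiteness
is inherited from the assumption that the process has these laws under a probability measure.

Conditional means. The next state is Ψ + ΥAΥ' with A the current state, so its mean needs only
second moments of the matrix normal law and the mean of an inverse Wishart matrix with diagonal
scale (`integral_nextState`). The latter comes from the inverse gamma marginals on the diagonal and
a sign symmetry off it. The noise is the deviation from the prediction; off the diagonal the
prediction has no forcing term because Q(I - R²) is diagonal. -/

noncomputable section

/-! ### Measurability of matrix operations -/

section Measurability

variable {m k l ι κ α : Type*} [MeasurableSpace α]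

instance instBorelSpaceMatrix [Countable m] [Countable k] : BorelSpace (Matrix m k ℝ) :=
  inferInstanceAs (BorelSpace (m → k → ℝ))

instance instSecondCountableMatrix [Countable m] [Countable k] :
    SecondCountableTopology (Matrix m k ℝ) :=
  inferInstanceAs (SecondCountableTopology (m → k → ℝ))

theorem measurable_matrix_entry (i : m) (j : k) : Measurable fun X : Matrix m k ℝ => X i j :=
  (measurable_pi_apply j).comp (measurable_pi_apply (X := fun _ : m => k → ℝ) i)

theorem measurable_matrix_iff {f : α → Matrix m k ℝ} :
    Measurable f ↔ ∀ i j, Measurable fun a => f a i j := by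
  refine ⟨fun h i j => (measurable_matrix_entry i j).comp h, fun h => ?_⟩
  exact measurable_pi_iff.2 fun i => measurable_pi_iff.2 fun j => h i j

theorem Measurable.matrix_entry {f : α → Matrix m k ℝ} (hf : Measurable f) (i : m) (j : k) :
    Measurable fun a => f a i j := measurable_matrix_iff.1 hf i j

@[fun_prop]
theorem Measurable.matrix_mul [Fintype k] {f : α → Matrix m k ℝ} {g : α → Matrix k l ℝ}
    (hf : Measurable f) (hg : Measurable g) : Measurable fun a => f a * g a := by
  refine measurable_matrix_iff.2 fun i j => ?_
  simp only [Matrix.mul_apply]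
  fun_prop

@[fun_prop]
theorem Measurable.matrix_transpose {f : α → Matrix m k ℝ} (hf : Measurable f) :
    Measurable fun a => (f a)ᵀ :=
  measurable_matrix_iff.2 fun i j => hf.matrix_entry j i

@[fun_prop]
theorem Measurable.matrix_add {f g : α → Matrix m k ℝ} (hf : Measurable f) (hg : Measurable g) :
    Measurable fun a => f a + g a :=
  measurable_matrix_iff.2 fun i j => (hf.matrix_entry i j).add (hg.matrix_entry i j)

@[fun_prop]
theorem Measurable.matrix_sub {f g : α → Matrix m k ℝ} (hf : Measurable f) (hg : Measurable g) :
    Measurable fun a => f a - g a :=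
  measurable_matrix_iff.2 fun i j => (hf.matrix_entry i j).sub (hg.matrix_entry i j)

@[fun_prop]
theorem Measurable.matrix_trace [Fintype m] {f : α → Matrix m m ℝ} (hf : Measurable f) :
    Measurable fun a => (f a).trace := by
  simp only [Matrix.trace, Matrix.diag]
  fun_prop

@[fun_prop]
theorem Measurable.matrix_det [Fintype m] [DecidableEq m] {f : α → Matrix m m ℝ}
    (hf : Measurable f) : Measurable fun a => (f a).det := by
  have : Measurable fun X : Matrix m m ℝ => X.det := (continuous_id.matrix_det).measurable
  exact this.comp hf

@[fun_prop]
-- Cramer's rule with the convention 0⁻¹ = 0 is measurable on all matrices, so no invertibility is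
-- needed.
theorem Measurable.matrix_inv [Fintype m] [DecidableEq m] {f : α → Matrix m m ℝ}
    (hf : Measurable f) : Measurable fun a => (f a)⁻¹ := by
  have h1 : Measurable fun X : Matrix m m ℝ => X.adjugate :=
    (continuous_id.matrix_adjugate).measurable
  refine measurable_matrix_iff.2 fun i j => ?_
  simp only [Matrix.inv_def, Matrix.smul_apply, Ring.inverse_eq_inv', smul_eq_mul]
  exact (hf.matrix_det.inv).mul ((h1.comp hf).matrix_entry i j)

@[fun_prop]
theorem Measurable.matrix_fromBlocks {m' k' : Type*} {f : α → Matrix m k ℝ}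
    {g : α → Matrix m k' ℝ} {h : α → Matrix m' k ℝ} {p : α → Matrix m' k' ℝ}
    (hf : Measurable f) (hg : Measurable g) (hh : Measurable h) (hp : Measurable p) :
    Measurable fun a => Matrix.fromBlocks (f a) (g a) (h a) (p a) := by
  refine measurable_matrix_iff.2 fun i j => ?_
  rcases i with i | i <;> rcases j with j | j <;> simp <;> fun_prop

@[fun_prop]
theorem Measurable.matrix_toBlocks₁₁ {m' k' : Type*} {f : α → Matrix (m ⊕ m') (k ⊕ k') ℝ}
    (hf : Measurable f) : Measurable fun a => (f a).toBlocks₁₁ :=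
  measurable_matrix_iff.2 fun _ _ => hf.matrix_entry _ _

@[fun_prop]
theorem Measurable.matrix_toBlocks₂₁ {m' k' : Type*} {f : α → Matrix (m ⊕ m') (k ⊕ k') ℝ}
    (hf : Measurable f) : Measurable fun a => (f a).toBlocks₂₁ :=
  measurable_matrix_iff.2 fun _ _ => hf.matrix_entry _ _

@[fun_prop]
theorem Measurable.matrix_toBlocks₂₂ {m' k' : Type*} {f : α → Matrix (m ⊕ m') (k ⊕ k') ℝ}
    (hf : Measurable f) : Measurable fun a => (f a).toBlocks₂₂ :=
  measurable_matrix_iff.2 fun _ _ => hf.matrix_entry _ _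

@[fun_prop]
theorem Measurable.matrix_submatrix {m' k' : Type*} {f : α → Matrix m k ℝ} (hf : Measurable f)
    (r : m' → m) (c : k' → k) : Measurable fun a => (f a).submatrix r c :=
  measurable_matrix_iff.2 fun _ _ => hf.matrix_entry _ _

/-- Strict positivity over all nonzero vectors is not visibly a measurable condition. It is replaced
by symmetry and semidefiniteness, which are closed, together with a nonvanishing determinant. -/
theorem measurableSet_posDef [Fintype ι] [DecidableEq ι] :
    MeasurableSet {X : Matrix ι ι ℝ | X.PosDef} := by
  have h : {X : Matrix ι ι ℝ | X.PosDef} = ({X | Xᵀ = X} ∩ ⋂ v : ι → ℝ, {X | 0 ≤ v ⬝ᵥ (X *ᵥ v)}) ∩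
      {X | X.det ≠ 0} := by
    ext X
    simp only [Set.mem_ofPred_eq, Set.mem_inter_iff, Set.mem_iInter]
    constructor
    · intro h
      refine ⟨⟨?_, fun v => ?_⟩, h.det_pos.ne'⟩
      · simpa [Matrix.IsHermitian] using h.isHermitian
      · simpa using h.posSemidef.dotProduct_mulVec_nonneg v
    · rintro ⟨⟨h1, h2⟩, h3⟩
      have h4 : X.PosSemidef := Matrix.PosSemidef.of_dotProduct_mulVec_nonneg
        (by simpa [Matrix.IsHermitian] using h1) (by simpa using h2)
      exact (h4.posDef_iff_isUnit).2 ((Matrix.isUnit_iff_isUnit_det _).2 (isUnit_iff_ne_zero.2 h3))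
  rw [h]
  refine MeasurableSet.inter (IsClosed.measurableSet ?_) ?_
  · refine IsClosed.inter ?_ (isClosed_iInter fun v => ?_)
    · exact isClosed_eq (continuous_id.matrix_transpose) continuous_id
    · exact isClosed_le continuous_const
        (continuous_const.dotProduct (continuous_id.matrix_mulVec continuous_const))
  · exact (measurableSet_singleton (0 : ℝ)).compl.preimage (measurable_id.matrix_det)

end Measurability

end

noncomputable section

/-! ### Change of variables for Lebesgue measure on matrices -/

section MatrixLebesgue

variable {m k : Type*} [Fintype m] [Fintype k]

theorem matrixLebesgue_eq_volume :
    matrixLebesgue m k = (volume : Measure (m → k → ℝ)) := Measure.map_id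

instance instSigmaFiniteMatrixLebesgue : SigmaFinite (matrixLebesgue m k) := by
  rw [matrixLebesgue_eq_volume]
  exact inferInstanceAs (SigmaFinite (volume : Measure (m → k → ℝ)))

theorem lintegral_matrixLebesgue_add (f : Matrix m k ℝ → ENNReal) (A : Matrix m k ℝ) :
    ∫⁻ X, f (X + A) ∂matrixLebesgue m k = ∫⁻ X, f X ∂matrixLebesgue m k := by
  rw [matrixLebesgue_eq_volume]
  exact lintegral_add_right_eq_self (μ := (volume : Measure (m → k → ℝ))) f A

variable (m k) in
/-- Vectorization as a measurable equivalence. -/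
def vecMeasurableEquiv : Matrix m k ℝ ≃ᵐ (k × m → ℝ) where
  toFun := Matrix.vec
  invFun x := Matrix.of fun i j => x (j, i)
  left_inv _ := rfl
  right_inv _ := rfl
  measurable_toFun := measurable_pi_iff.2 fun p => measurable_matrix_entry p.2 p.1
  measurable_invFun := measurable_matrix_iff.2 fun i j => measurable_pi_apply (j, i)

theorem map_vec_matrixLebesgue :
    (matrixLebesgue m k).map (vecMeasurableEquiv m k) = volume := by
  symm
  refine Measure.pi_eq fun s hs => ?_
  rw [MeasurableEquiv.map_apply, matrixLebesgue_eq_volume]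
  have : vecMeasurableEquiv m k ⁻¹' Set.univ.pi s =
      Set.univ.pi fun i : m => Set.univ.pi fun j : k => s (j, i) := by
    ext X
    exact ⟨fun h i _ j _ => h (j, i) trivial, fun h p _ => h p.2 trivial p.1 trivial⟩
  rw [this]
  refine (Measure.pi_pi _ _).trans ?_
  rw [Fintype.prod_prod_type_right]
  exact Finset.prod_congr rfl fun i _ => Measure.pi_pi _ _

/-- After stacking columns, Z ↦ PZW is the Kronecker product of W' and P, whose determinant is det W
to the number of rows times det P to the number of columns. -/
theorem map_mul_mul_matrixLebesgue [DecidableEq m] [DecidableEq k] {P : Matrix m m ℝ}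
    {W : Matrix k k ℝ} (hP : P.det ≠ 0) (hW : W.det ≠ 0) :
    (matrixLebesgue m k).map (fun Z => P * Z * W) =
      (ENNReal.ofReal (|P.det| ^ Fintype.card k * |W.det| ^ Fintype.card m))⁻¹ •
        matrixLebesgue m k := by
  refine (vecMeasurableEquiv m k).map_measurableEquiv_injective ?_
  have h1 : (vecMeasurableEquiv m k) ∘ (fun Z => P * Z * W) =
      toLin' (kroneckerMap (· * ·) Wᵀ P) ∘ vecMeasurableEquiv m k := by
    funext Z
    have := kronecker_mulVec_vec P Z Wᵀ
    rw [transpose_transpose] at this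
    exact this.symm
  have h2 : (kroneckerMap (· * ·) Wᵀ P).det ≠ 0 := by
    rw [det_kronecker, det_transpose]
    positivity
  have h3 : Measurable (toLin' (kroneckerMap (· * ·) Wᵀ P)) :=
    (LinearMap.continuous_of_finiteDimensional _).measurable
  rw [Measure.map_map (vecMeasurableEquiv m k).measurable (by fun_prop), h1,
    ← Measure.map_map h3 (vecMeasurableEquiv m k).measurable, map_vec_matrixLebesgue,
    Real.map_matrix_volume_pi_eq_smul_volume_pi h2, Measure.map_smul, map_vec_matrixLebesgue,
    det_kronecker, det_transpose, abs_inv, ENNReal.ofReal_inv_of_pos (by positivity), abs_mul,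
    abs_pow, abs_pow, mul_comm]

theorem lintegral_mul_mul_matrixLebesgue [DecidableEq m] [DecidableEq k] {P : Matrix m m ℝ}
    {W : Matrix k k ℝ} (hP : P.det ≠ 0) (hW : W.det ≠ 0) {f : Matrix m k ℝ → ENNReal}
    (hf : Measurable f) :
    ∫⁻ X, f X ∂matrixLebesgue m k =
      ENNReal.ofReal (|P.det| ^ Fintype.card k * |W.det| ^ Fintype.card m) *
        ∫⁻ Z, f (P * Z * W) ∂matrixLebesgue m k := by
  have h0 : ENNReal.ofReal (|P.det| ^ Fintype.card k * |W.det| ^ Fintype.card m) ≠ 0 := by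
    rw [ENNReal.ofReal_ne_zero_iff]; positivity
  rw [← lintegral_map (f := f) (g := fun Z => P * Z * W) hf (by fun_prop),
    map_mul_mul_matrixLebesgue hP hW, lintegral_smul_measure, smul_eq_mul, ← mul_assoc,
    ENNReal.mul_inv_cancel h0 ENNReal.ofReal_ne_top, one_mul]

end MatrixLebesgue

/-! ### Lebesgue measure on symmetric matrices -/

section SymmLebesgue

set_option linter.unusedSectionVars false

variable {ι κ : Type*} [Fintype ι] [DecidableEq ι] [Fintype κ] [DecidableEq κ]

/-- The symmetric matrix with given entries. -/
def symmMatrix {ι : Type*} (x : Sym2 ι → ℝ) : Matrix ι ι ℝ := Matrix.of fun i j => x s(i, j)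

theorem measurable_symmMatrix : Measurable (symmMatrix (ι := ι)) :=
  measurable_matrix_iff.2 fun i j => measurable_pi_apply s(i, j)

theorem transpose_symmMatrix (x : Sym2 ι → ℝ) : (symmMatrix x)ᵀ = symmMatrix x := by
  ext i j
  simp [symmMatrix, Sym2.eq_swap]

theorem symmLebesgue_eq_map : symmLebesgue ι = volume.map (symmMatrix (ι := ι)) := rfl

instance instSFiniteSymmLebesgue : SFinite (symmLebesgue ι) := by
  rw [symmLebesgue_eq_map]; infer_instance

theorem lintegral_symmLebesgue {f : Matrix ι ι ℝ → ENNReal} (hf : Measurable f) :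
    ∫⁻ X, f X ∂symmLebesgue ι = ∫⁻ x, f (symmMatrix x) := by
  rw [symmLebesgue_eq_map, lintegral_map hf measurable_symmMatrix]

/-- The entries of a symmetric matrix, indexed by unordered pairs. -/
def symmEntries {ι : Type*} (A : Matrix ι ι ℝ) (hA : Aᵀ = A) : Sym2 ι → ℝ :=
  Sym2.lift ⟨fun i j => A i j, fun i j => congrFun (congrFun hA j) i⟩

theorem symmMatrix_injective : Function.Injective (symmMatrix (ι := ι)) := by
  intro x y h
  funext s
  induction s with | _ i j => exact congrFun (congrFun h i) j

theorem lintegral_symmLebesgue_add {f : Matrix ι ι ℝ → ENNReal} (hf : Measurable f)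
    {A : Matrix ι ι ℝ} (hA : Aᵀ = A) :
    ∫⁻ X, f (X + A) ∂symmLebesgue ι = ∫⁻ X, f X ∂symmLebesgue ι := by
  rw [lintegral_symmLebesgue hf, lintegral_symmLebesgue (f := fun X => f (X + A)) (by fun_prop)]
  exact lintegral_add_right_eq_self (fun x => f (symmMatrix x)) (symmEntries A hA)

/-- Transport of unordered pairs along an equivalence. -/
def sym2Congr {ι κ : Type*} (e : ι ≃ κ) : Sym2 ι ≃ Sym2 κ where
  toFun := Sym2.map e
  invFun := Sym2.map e.symm
  left_inv s := by simp [Sym2.map_map]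
  right_inv s := by simp [Sym2.map_map]

/-- Relabelling indices merely permutes the coordinates indexed by unordered pairs. -/
theorem lintegral_symmLebesgue_reindex (e : ι ≃ κ) {f : Matrix κ κ ℝ → ENNReal}
    (hf : Measurable f) :
    ∫⁻ X, f X ∂symmLebesgue κ = ∫⁻ X, f (X.submatrix e.symm e.symm) ∂symmLebesgue ι := by
  rw [lintegral_symmLebesgue hf,
    lintegral_symmLebesgue (f := fun X : Matrix ι ι ℝ => f (X.submatrix e.symm e.symm))
      (by fun_prop)]
  have h := volume_measurePreserving_piCongrLeft (fun _ : Sym2 κ => ℝ) (sym2Congr e)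
  refine (h.lintegral_comp (hf.comp measurable_symmMatrix)).symm.trans ?_
  refine lintegral_congr fun x => ?_
  simp only [Function.comp]
  congr 1
  ext i j
  simp only [symmMatrix, Matrix.of_apply, Matrix.submatrix_apply]
  have := MeasurableEquiv.piCongrLeft_apply_apply (β := fun _ : Sym2 κ => ℝ) (sym2Congr e) x
    s(e.symm i, e.symm j)
  have h' : sym2Congr e s(e.symm i, e.symm j) = s(i, j) := by simp [sym2Congr]
  rwa [h'] at this

/-- Unordered pairs in a disjoint union. -/
def sym2SumEquiv (ι κ : Type*) : (Sym2 ι ⊕ ((ι × κ) ⊕ Sym2 κ)) ≃ Sym2 (ι ⊕ κ) :=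
  Equiv.ofBijective
    (Sum.elim (Sym2.map Sum.inl) (Sum.elim (fun p => s(Sum.inr p.2, Sum.inl p.1))
      (Sym2.map Sum.inr))) <| by
    constructor
    · rintro (s | ⟨a, b⟩ | s) (t | ⟨c, d⟩ | t) h
      · simpa using Sym2.map.injective Sum.inl_injective h
      · induction s with | _ i j => simp at h
      · induction s with | _ i j => induction t with | _ k l => simp at h
      · induction t with | _ i j => simp at h
      · simpa [and_comm] using h
      · induction t with | _ i j => simp at h
      · induction s with | _ i j => induction t with | _ k l => simp at h
      · induction s with | _ i j => simp at h
      · simpa using Sym2.map.injective Sum.inr_injective h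
    · intro s
      induction s with | _ i j =>
      rcases i with i | i <;> rcases j with j | j
      · exact ⟨Sum.inl s(i, j), rfl⟩
      · exact ⟨Sum.inr (Sum.inl (i, j)), Sym2.eq_swap⟩
      · exact ⟨Sum.inr (Sum.inl (j, i)), rfl⟩
      · exact ⟨Sum.inr (Sum.inr s(i, j)), rfl⟩

/-- An unordered pair in a disjoint union lies in the first part, in the second, or across the two.
The coordinates split accordingly into the two symmetric diagonal blocks and one free off-diagonal
block, and Tonelli applies. -/
theorem lintegral_symmLebesgue_fromBlocks {f : Matrix (ι ⊕ κ) (ι ⊕ κ) ℝ → ENNReal}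
    (hf : Measurable f) :
    ∫⁻ X, f X ∂symmLebesgue (ι ⊕ κ) =
      ∫⁻ A, ∫⁻ B, ∫⁻ C, f (fromBlocks A Bᵀ B C) ∂symmLebesgue κ ∂matrixLebesgue κ ι
        ∂symmLebesgue ι := by
  have h1 := volume_measurePreserving_piCongrLeft (fun _ : Sym2 (ι ⊕ κ) => ℝ) (sym2SumEquiv ι κ)
  have h2 := (volume_measurePreserving_sumPiEquivProdPi
    (fun _ : Sym2 ι ⊕ ((ι × κ) ⊕ Sym2 κ) => ℝ)).symm
  have h3 := (volume_measurePreserving_sumPiEquivProdPi (fun _ : (ι × κ) ⊕ Sym2 κ => ℝ)).symm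
  have hG := h1.comp (h2.comp
    ((MeasurePreserving.id (volume : Measure (Sym2 ι → ℝ))).prod h3))
  have hV : MeasurePreserving (vecMeasurableEquiv κ ι).symm volume (matrixLebesgue κ ι) :=
    (MeasurePreserving.symm _ ⟨MeasurableEquiv.measurable _, map_vec_matrixLebesgue⟩)
  have hC : Measurable fun p : Matrix ι ι ℝ × Matrix κ ι ℝ =>
      ∫⁻ C, f (fromBlocks p.1 p.2ᵀ p.2 C) ∂symmLebesgue κ :=
    Measurable.lintegral_prod_right' (f := fun q : (Matrix ι ι ℝ × Matrix κ ι ℝ) × Matrix κ κ ℝ =>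
      f (fromBlocks q.1.1 q.1.2ᵀ q.1.2 q.2)) (by fun_prop)
  have hS := measurable_symmMatrix (ι := ι)
  have hS' := measurable_symmMatrix (ι := κ)
  rw [lintegral_symmLebesgue hf]
  refine (hG.lintegral_comp (hf.comp measurable_symmMatrix)).symm.trans ?_
  calc _ = ∫⁻ p : (Sym2 ι → ℝ) × (ι × κ → ℝ) × (Sym2 κ → ℝ),
        f (fromBlocks (symmMatrix p.1) ((vecMeasurableEquiv κ ι).symm p.2.1)ᵀ
          ((vecMeasurableEquiv κ ι).symm p.2.1) (symmMatrix p.2.2))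
          ∂(volume.prod (volume.prod volume)) := ?_
    _ = _ := ?_
  · refine lintegral_congr fun ⟨a, b, c⟩ => congrArg f ?_
    have key (s) := MeasurableEquiv.piCongrLeft_apply_apply (β := fun _ : Sym2 (ι ⊕ κ) => ℝ)
      (sym2SumEquiv ι κ) ((MeasurableEquiv.sumPiEquivProdPi
        fun _ : Sym2 ι ⊕ ((ι × κ) ⊕ Sym2 κ) => ℝ).symm
        (a, (MeasurableEquiv.sumPiEquivProdPi fun _ : (ι × κ) ⊕ Sym2 κ => ℝ).symm (b, c))) s
    ext i j
    rcases i with i | i <;> rcases j with j | j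
    · exact key (Sum.inl s(i, j))
    -- The upper right block has no coordinates of its own: its entries are read from the lower left
    -- block through the swapped pair.
    · refine Eq.trans ?_ (key (Sum.inr (Sum.inl (i, j))))
      simp only [symmMatrix, Matrix.of_apply]
      rw [Sym2.eq_swap]; rfl
    · exact key (Sum.inr (Sum.inl (j, i)))
    · exact key (Sum.inr (Sum.inr s(i, j)))
  · have hm : Measurable fun p : (Sym2 ι → ℝ) × (ι × κ → ℝ) × (Sym2 κ → ℝ) =>
        f (fromBlocks (symmMatrix p.1) ((vecMeasurableEquiv κ ι).symm p.2.1)ᵀ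
          ((vecMeasurableEquiv κ ι).symm p.2.1) (symmMatrix p.2.2)) := by
      refine hf.comp ?_
      have h := (vecMeasurableEquiv κ ι).symm.measurable
      exact (hS.comp measurable_fst).matrix_fromBlocks
        (h.comp (measurable_fst.comp measurable_snd)).matrix_transpose
        (h.comp (measurable_fst.comp measurable_snd))
        (hS'.comp (measurable_snd.comp measurable_snd))
    rw [lintegral_prod _ hm.aemeasurable,
      lintegral_symmLebesgue (hC.lintegral_prod_right' (ν := matrixLebesgue κ ι))]
    refine lintegral_congr fun a => ?_
    refine (lintegral_prod _ (hm.comp (measurable_prodMk_left (x := a))).aemeasurable).trans ?_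
    rw [← hV.lintegral_comp (f := fun B => ∫⁻ C, f (fromBlocks (symmMatrix a) Bᵀ B C) ∂symmLebesgue κ)
        (hC.comp measurable_prodMk_left)]
    refine lintegral_congr fun b => ?_
    rw [lintegral_symmLebesgue (f := fun C => f (fromBlocks (symmMatrix a) _ _ C)) (by fun_prop)]
    rfl

/-- The action `X ↦ T X T'` on symmetric matrices, in coordinates. -/
def symmCongruence (T : Matrix ι ι ℝ) : (Sym2 ι → ℝ) →ₗ[ℝ] (Sym2 ι → ℝ) where
  toFun x := symmEntries (T * symmMatrix x * Tᵀ) (by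
    simp only [transpose_mul, transpose_transpose, transpose_symmMatrix, mul_assoc])
  map_add' x y := symmMatrix_injective <| by
    have h : symmMatrix (x + y) = symmMatrix x + symmMatrix y := rfl
    change T * symmMatrix (x + y) * Tᵀ = T * symmMatrix x * Tᵀ + T * symmMatrix y * Tᵀ
    rw [h, mul_add, add_mul]
  map_smul' c x := symmMatrix_injective <| by
    have h : symmMatrix (c • x) = c • symmMatrix x := rfl
    change T * symmMatrix (c • x) * Tᵀ = c • (T * symmMatrix x * Tᵀ)
    rw [h, Matrix.mul_smul, Matrix.smul_mul]

theorem symmMatrix_symmCongruence (T : Matrix ι ι ℝ) (x : Sym2 ι → ℝ) :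
    symmMatrix (symmCongruence T x) = T * symmMatrix x * Tᵀ := rfl

theorem symmCongruence_mul (T U : Matrix ι ι ℝ) :
    symmCongruence (T * U) = symmCongruence T ∘ₗ symmCongruence U := by
  refine LinearMap.ext fun x => symmMatrix_injective ?_
  simp only [LinearMap.comp_apply, symmMatrix_symmCongruence, transpose_mul, mul_assoc]

theorem symmCongruence_one : symmCongruence (1 : Matrix ι ι ℝ) = LinearMap.id := by
  refine LinearMap.ext fun x => symmMatrix_injective ?_
  simp [symmMatrix_symmCongruence]

theorem sq_le_trace_mul_transpose (X : Matrix ι ι ℝ) (i j : ι) : X i j ^ 2 ≤ (X * Xᵀ).trace := by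
  simp only [Matrix.trace, Matrix.diag, Matrix.mul_apply, Matrix.transpose_apply, ← sq]
  calc X i j ^ 2 ≤ ∑ l, X i l ^ 2 :=
        Finset.single_le_sum (f := fun l => X i l ^ 2) (fun _ _ => sq_nonneg _) (Finset.mem_univ j)
    _ ≤ _ := Finset.single_le_sum (f := fun k => ∑ l, X k l ^ 2)
        (fun _ _ => Finset.sum_nonneg fun _ _ => sq_nonneg _) (Finset.mem_univ i)

/-- The determinant is not computed. The Frobenius unit ball is invariant under the map and has
finite nonzero volume, which forces the volume factor to be 1. -/
theorem abs_det_symmCongruence {T : Matrix ι ι ℝ} (hT : Tᵀ * T = 1) :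
    |LinearMap.det (symmCongruence T)| = 1 := by
  -- Congruence by T' is an inverse, so the determinant cannot vanish.
  have hdet : LinearMap.det (symmCongruence T) ≠ 0 := by
    intro h
    have h1 := congrArg LinearMap.det ((symmCongruence_mul Tᵀ T).symm.trans
      ((congrArg symmCongruence hT).trans symmCongruence_one))
    rw [LinearMap.det_comp, h] at h1
    simp at h1
  set B : Set (Sym2 ι → ℝ) := {x | (symmMatrix x * (symmMatrix x)ᵀ).trace ≤ 1} with hB
  have hpre : symmCongruence T ⁻¹' B = B := by
    ext x
    simp only [hB, Set.mem_preimage, Set.mem_ofPred_eq, symmMatrix_symmCongruence, transpose_mul,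
      transpose_transpose]
    have : T * symmMatrix x * Tᵀ * (T * ((symmMatrix x)ᵀ * Tᵀ)) =
        T * (symmMatrix x * (symmMatrix x)ᵀ) * Tᵀ := by
      calc _ = T * symmMatrix x * (Tᵀ * T) * ((symmMatrix x)ᵀ * Tᵀ) := by
            simp only [mul_assoc]
        _ = _ := by rw [hT]; simp only [mul_assoc, mul_one]
    rw [this, trace_mul_comm, ← mul_assoc, hT, one_mul]
  -- Each entry is bounded by the Frobenius norm, so the ball is bounded in the sup norm of the
  -- coordinates.
  have htop : volume B ≠ ⊤ := by
    have hsub : B ⊆ Metric.closedBall 0 1 := by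
      intro x hx
      rw [mem_closedBall_zero_iff, pi_norm_le_iff_of_nonneg zero_le_one]
      intro s
      induction s with | _ i j =>
      have h1 : (symmMatrix x i j) ^ 2 ≤ 1 := (sq_le_trace_mul_transpose _ i j).trans hx
      rw [Real.norm_eq_abs]
      exact (sq_le_one_iff_abs_le_one _).1 h1
    exact ((measure_mono hsub).trans_lt measure_closedBall_lt_top).ne
  have hzero : volume B ≠ 0 := by
    have hc : Continuous fun x : Sym2 ι → ℝ => (symmMatrix x * (symmMatrix x)ᵀ).trace := by
      have : Continuous (symmMatrix (ι := ι)) :=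
        continuous_matrix fun i j => continuous_apply s(i, j)
      exact (this.matrix_mul this.matrix_transpose).matrix_trace
    have ho : IsOpen {x : Sym2 ι → ℝ | (symmMatrix x * (symmMatrix x)ᵀ).trace < 1} :=
      isOpen_lt hc continuous_const
    have hpos := ho.measure_pos volume ⟨0, by
      have : symmMatrix (0 : Sym2 ι → ℝ) = 0 := rfl
      simp [this]⟩
    have hsub : {x : Sym2 ι → ℝ | (symmMatrix x * (symmMatrix x)ᵀ).trace < 1} ⊆ B := by
      intro x hx
      simp only [hB, Set.mem_ofPred_eq] at hx ⊢
      exact hx.le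
    exact (hpos.trans_le (measure_mono hsub)).ne'
  have h := Measure.addHaar_preimage_linearMap volume hdet B
  rw [hpre] at h
  have h1 : ENNReal.ofReal |(LinearMap.det (symmCongruence T))⁻¹| = 1 := by
    have := congrArg (· * (volume B)⁻¹) h
    simpa [mul_assoc, ENNReal.mul_inv_cancel hzero htop] using this.symm
  rw [ENNReal.ofReal_eq_one, abs_inv, inv_eq_one] at h1
  exact h1

theorem map_congruence_symmLebesgue {T : Matrix ι ι ℝ} (hT : Tᵀ * T = 1) :
    (symmLebesgue ι).map (fun X => T * X * Tᵀ) = symmLebesgue ι := by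
  have h1 := abs_det_symmCongruence hT
  have h0 : LinearMap.det (symmCongruence T) ≠ 0 := by
    intro h; simp [h] at h1
  have hm : Measurable (symmCongruence T) :=
    (LinearMap.continuous_of_finiteDimensional _).measurable
  have h2 := Measure.map_linearMap_addHaar_eq_smul_addHaar volume h0
  rw [abs_inv, h1, inv_one, ENNReal.ofReal_one, one_smul] at h2
  rw [symmLebesgue_eq_map, Measure.map_map (by fun_prop) measurable_symmMatrix]
  conv_rhs => rw [← h2]
  rw [Measure.map_map measurable_symmMatrix hm]
  rfl

end SymmLebesgue

end

noncomputable section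

/-! ### The matrix normal distribution -/

section StdGaussian

variable {r : Type*} [Fintype r]

theorem pi_gaussianReal_eq_withDensity :
    Measure.pi (fun _ : r => gaussianReal 0 1) =
      (volume : Measure (r → ℝ)).withDensity fun x =>
        ENNReal.ofReal ((2 * Real.pi) ^ (-(Fintype.card r : ℝ) / 2) *
          Real.exp (-(∑ i, x i ^ 2) / 2)) := by
  have hg : (fun x : r → ℝ => ENNReal.ofReal ((2 * Real.pi) ^ (-(Fintype.card r : ℝ) / 2) *
          Real.exp (-(∑ i, x i ^ 2) / 2))) =
      fun x => ENNReal.ofReal (∏ i, gaussianPDFReal 0 1 (x i)) := by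
    funext x
    congr 1
    simp only [gaussianPDFReal, NNReal.coe_one, mul_one, sub_zero, Finset.prod_mul_distrib,
      Finset.prod_const, Finset.card_univ]
    rw [← Real.exp_sum, ← Finset.sum_div, Finset.sum_neg_distrib, Real.sqrt_eq_rpow,
      ← Real.rpow_neg (by positivity), ← Real.rpow_natCast, ← Real.rpow_mul (by positivity)]
    congr 2
    ring
  rw [hg]
  refine Measure.pi_eq fun s hs => ?_
  rw [withDensity_apply _ (MeasurableSet.univ_pi hs),
    ← lintegral_indicator (MeasurableSet.univ_pi hs)]
  -- On a box the indicator is a product over coordinates, so the integral of the density splits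
  -- into one-dimensional Gaussian integrals.
  have h1 : ∀ x : r → ℝ, (Set.univ.pi s).indicator
      (fun x => ENNReal.ofReal (∏ i, gaussianPDFReal 0 1 (x i))) x =
      ENNReal.ofReal (∏ i, (s i).indicator (gaussianPDFReal 0 1) (x i)) := by
    intro x
    by_cases hx : x ∈ Set.univ.pi s
    · rw [Set.indicator_of_mem hx]
      congr 1
      exact Finset.prod_congr rfl fun i _ => (Set.indicator_of_mem (hx i trivial) _).symm
    · rw [Set.indicator_of_notMem hx]
      have : ∃ i, x i ∉ s i := by simpa [Set.mem_univ_pi] using hx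
      obtain ⟨i, hi⟩ := this
      rw [Finset.prod_eq_zero (Finset.mem_univ i) (Set.indicator_of_notMem hi _),
        ENNReal.ofReal_zero]
  have hint : ∀ i, Integrable ((s i).indicator (gaussianPDFReal 0 1)) := fun i =>
    (integrable_gaussianPDFReal 0 1).indicator (hs i)
  have hprod : Integrable (fun x : r → ℝ => ∏ i, (s i).indicator (gaussianPDFReal 0 1) (x i)) :=
    Integrable.fintype_prod hint
  simp_rw [h1]
  rw [← ofReal_integral_eq_lintegral_ofReal
    hprod
    (Filter.Eventually.of_forall fun x => Finset.prod_nonneg fun i _ =>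
      Set.indicator_nonneg (fun _ _ => gaussianPDFReal_nonneg _ _ _) _),
    integral_fintype_prod_volume_eq_prod (fun i => (s i).indicator (gaussianPDFReal 0 1)),
    ENNReal.ofReal_prod_of_nonneg]
  · refine Finset.prod_congr rfl fun i _ => ?_
    rw [gaussianReal_apply_eq_integral _ one_ne_zero, integral_indicator (hs i)]
  · exact fun i _ => integral_nonneg fun x =>
      Set.indicator_nonneg (fun _ _ => gaussianPDFReal_nonneg _ _ _) _

theorem memLp_eval_pi_gaussianReal (i : r) :
    MemLp (fun x : r → ℝ => x i) 2 (Measure.pi fun _ : r => gaussianReal 0 1) :=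
  (memLp_id_gaussianReal' 2 (by simp)).comp_measurePreserving
    (measurePreserving_eval (fun _ : r => gaussianReal 0 1) i)

theorem integral_eval_pi_gaussianReal (i : r) :
    ∫ x : r → ℝ, x i ∂(Measure.pi fun _ : r => gaussianReal 0 1) = 0 :=
  (integral_eval (μ := fun _ : r => gaussianReal 0 1)).trans integral_id_gaussianReal

theorem integral_eval_mul_eval_pi_gaussianReal [DecidableEq r] (i j : r) :
    ∫ x : r → ℝ, x i * x j ∂(Measure.pi fun _ : r => gaussianReal 0 1) =
      if i = j then 1 else 0 := by
  split_ifs with h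
  · subst h
    have h1 := variance_fun_id_gaussianReal (μ := 0) (v := 1)
    rw [variance_of_integral_eq_zero (X := fun x : ℝ => x) aemeasurable_id integral_id_gaussianReal] at h1
    rw [integral_comp_eval (μ := fun _ : r => gaussianReal 0 1) (i := i)
      (f := fun y : ℝ => y * y) (by fun_prop)]
    simpa [sq] using h1
  · have hind := (iIndepFun_pi (μ := fun _ : r => gaussianReal 0 1)
      (X := fun _ (y : ℝ) => y) fun _ => aemeasurable_id).indepFun h
    rw [hind.integral_fun_mul_eq_mul_integral (memLp_eval_pi_gaussianReal i).1
      (memLp_eval_pi_gaussianReal j).1,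
      integral_eval_pi_gaussianReal, zero_mul]

theorem memLp_affine_pi_gaussianReal (a : ℝ) (α : r → ℝ) :
    MemLp (fun x : r → ℝ => a + ∑ i, α i * x i) 2 (Measure.pi fun _ : r => gaussianReal 0 1) :=
  (memLp_const a).add (memLp_finsetSum _ fun i _ => (memLp_eval_pi_gaussianReal i).const_mul (α i))

/-- The linear terms have mean zero, and of the quadratic terms only the diagonal ones survive
because the coordinates are uncorrelated with unit variance. -/
theorem integral_affine_mul_affine_pi_gaussianReal (a b : ℝ) (α β : r → ℝ) :
    ∫ x : r → ℝ, (a + ∑ i, α i * x i) * (b + ∑ i, β i * x i)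
      ∂(Measure.pi fun _ : r => gaussianReal 0 1) = a * b + ∑ i, α i * β i := by
  classical
  have h1 : ∀ i, Integrable (fun x : r → ℝ => x i) (Measure.pi fun _ : r => gaussianReal 0 1) :=
    fun i => (memLp_eval_pi_gaussianReal i).integrable (by norm_num)
  have h2 : ∀ i j, Integrable (fun x : r → ℝ => x i * x j)
      (Measure.pi fun _ : r => gaussianReal 0 1) :=
    fun i j => (memLp_eval_pi_gaussianReal i).integrable_mul (memLp_eval_pi_gaussianReal j)
  have h3 : ∀ x : r → ℝ, (a + ∑ i, α i * x i) * (b + ∑ i, β i * x i) =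
      (a * b + ∑ i, (a * β i + b * α i) * x i) + ∑ i, ∑ j, (α i * β j) * (x i * x j) := by
    intro x
    have : ∑ i, ∑ j, (α i * β j) * (x i * x j) = (∑ i, α i * x i) * ∑ i, β i * x i := by
      rw [Finset.sum_mul_sum]
      exact Finset.sum_congr rfl fun i _ => Finset.sum_congr rfl fun j _ => by ring
    rw [this]
    simp only [add_mul, Finset.sum_add_distrib, mul_assoc, ← Finset.mul_sum]
    ring
  simp_rw [h3]
  rw [integral_add, integral_add, integral_finsetSum, integral_finsetSum]
  · simp_rw [integral_const_mul, integral_eval_pi_gaussianReal]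
    have : ∀ i, ∫ x : r → ℝ, ∑ j, (α i * β j) * (x i * x j)
        ∂(Measure.pi fun _ : r => gaussianReal 0 1) = α i * β i := by
      intro i
      rw [integral_finsetSum _ fun j _ => (h2 i j).const_mul _]
      simp_rw [integral_const_mul, integral_eval_mul_eval_pi_gaussianReal]
      simp
    simp [this]
  · exact fun i _ => integrable_finsetSum _ fun j _ => (h2 i j).const_mul _
  · exact fun i _ => (h1 i).const_mul _
  · exact integrable_const _
  · exact integrable_finsetSum _ fun i _ => (h1 i).const_mul _
  · exact (integrable_const _).add (integrable_finsetSum _ fun i _ => (h1 i).const_mul _)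
  · exact integrable_finsetSum _ fun i _ => integrable_finsetSum _ fun j _ => (h2 i j).const_mul _

end StdGaussian

/-! ### Matrix normal laws as affine images of independent standard Gaussians. -/

section MatrixNormal

variable {m k : Type*} [Fintype m] [DecidableEq m] [Fintype k] [DecidableEq k]

theorem Matrix.PosDef.exists_transpose_mul_self {U : Matrix m m ℝ} (hU : U.PosDef) :
    ∃ P : Matrix m m ℝ, U = Pᵀ * P := by
  open scoped MatrixOrder in
  obtain ⟨B, hB⟩ := CStarAlgebra.nonneg_iff_eq_star_mul_self.mp hU.posSemidef.nonneg
  exact ⟨B, by rw [hB, star_eq_conjTranspose, conjTranspose_eq_transpose_of_trivial]⟩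

/-- The density of the matrix normal distribution with respect to Lebesgue measure. -/
def matrixNormalPDFReal (M : Matrix m k ℝ) (U : Matrix m m ℝ) (V : Matrix k k ℝ)
    (X : Matrix m k ℝ) : ℝ :=
  (2 * Real.pi) ^ (-((Fintype.card m : ℝ) * (Fintype.card k : ℝ)) / 2) *
    U.det ^ (-(Fintype.card k : ℝ) / 2) * V.det ^ (-(Fintype.card m : ℝ) / 2) *
    Real.exp (-(V⁻¹ * (X - M)ᵀ * U⁻¹ * (X - M)).trace / 2)

theorem matrixNormal_eq_withDensity (M : Matrix m k ℝ) (U : Matrix m m ℝ) (V : Matrix k k ℝ) :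
    matrixNormal M U V = (matrixLebesgue m k).withDensity fun X =>
      ENNReal.ofReal (matrixNormalPDFReal M U V X) := rfl

theorem measurable_matrixNormalPDFReal (M : Matrix m k ℝ) (U : Matrix m m ℝ) (V : Matrix k k ℝ) :
    Measurable (matrixNormalPDFReal M U V) := by
  unfold matrixNormalPDFReal
  fun_prop

/-- A matrix with the given standard Gaussian entries, transformed to `M + P' Z W`. -/
theorem matrixNormal_eq_map (M : Matrix m k ℝ) {P : Matrix m m ℝ} {W : Matrix k k ℝ}
    (hP : P.det ≠ 0) (hW : W.det ≠ 0) :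
    matrixNormal M (Pᵀ * P) (Wᵀ * W) =
      (Measure.pi fun _ : k × m => gaussianReal 0 1).map
        fun z => Pᵀ * (vecMeasurableEquiv m k).symm z * W + M := by
  have hm : Measurable fun z => Pᵀ * (vecMeasurableEquiv m k).symm z * W + M := by
    have := (vecMeasurableEquiv m k).symm.measurable
    fun_prop
  refine Measure.ext_of_lintegral _ fun f hf => ?_
  rw [lintegral_map hf hm, pi_gaussianReal_eq_withDensity, matrixNormal_eq_withDensity,
    lintegral_withDensity_eq_lintegral_mul _
      (measurable_matrixNormalPDFReal _ _ _).ennreal_ofReal hf,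
    lintegral_withDensity_eq_lintegral_mul _ (by fun_prop)
      (g := fun z => f (Pᵀ * (vecMeasurableEquiv m k).symm z * W + M)) (hf.comp hm),
    ← map_vec_matrixLebesgue,
    lintegral_map_equiv,
    ← lintegral_matrixLebesgue_add _ M,
    lintegral_mul_mul_matrixLebesgue (P := Pᵀ) (W := W) (by rwa [det_transpose]) hW
      (by
        have h1 := (measurable_matrixNormalPDFReal M (Pᵀ * P) (Wᵀ * W)).ennreal_ofReal.mul hf
        exact h1.comp (by fun_prop)),
    ← lintegral_const_mul' _ _ ENNReal.ofReal_ne_top]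
  refine lintegral_congr fun Z => ?_
  simp only [Pi.mul_apply, MeasurableEquiv.symm_apply_apply]
  rw [← mul_assoc, ← ENNReal.ofReal_mul (by positivity)]
  congr 2
  have hPd : (0 : ℝ) < |P.det| := abs_pos.2 hP
  have hWd : (0 : ℝ) < |W.det| := abs_pos.2 hW
  -- Whitening: the factors P and W cancel against the inverse covariances, leaving the squared
  -- Frobenius norm of Z.
  have htr : ((Wᵀ * W)⁻¹ * (Pᵀ * Z * W)ᵀ * (Pᵀ * P)⁻¹ * (Pᵀ * Z * W)).trace =
      ∑ p : k × m, (vecMeasurableEquiv m k Z) p ^ 2 := by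
    have hP1 : P * P⁻¹ = 1 := mul_nonsing_inv _ (isUnit_iff_ne_zero.2 hP)
    have hP2 : P⁻¹ * P = 1 := nonsing_inv_mul _ (isUnit_iff_ne_zero.2 hP)
    have hW1 : W * W⁻¹ = 1 := mul_nonsing_inv _ (isUnit_iff_ne_zero.2 hW)
    have hP3 : (Pᵀ)⁻¹ * Pᵀ = 1 :=
      nonsing_inv_mul _ (isUnit_iff_ne_zero.2 (by rwa [det_transpose]))
    have hW3 : (Wᵀ)⁻¹ * Wᵀ = 1 :=
      nonsing_inv_mul _ (isUnit_iff_ne_zero.2 (by rwa [det_transpose]))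
    have e : (Wᵀ * W)⁻¹ * (Pᵀ * Z * W)ᵀ * (Pᵀ * P)⁻¹ * (Pᵀ * Z * W) =
        W⁻¹ * (Zᵀ * Z * W) := by
      rw [Matrix.mul_inv_rev, Matrix.mul_inv_rev, transpose_mul, transpose_mul,
        transpose_transpose]
      calc _ = W⁻¹ * ((Wᵀ)⁻¹ * Wᵀ) * Zᵀ * (P * P⁻¹) * ((Pᵀ)⁻¹ * Pᵀ) * Z * W := by
            simp only [Matrix.mul_assoc]
        _ = _ := by rw [hW3, hP1, hP3]; simp only [Matrix.mul_assoc, Matrix.mul_one]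
    rw [e, trace_mul_comm, Matrix.mul_assoc, hW1, Matrix.mul_one, Fintype.sum_prod_type]
    simp only [Matrix.trace, Matrix.diag, Matrix.mul_apply, Matrix.transpose_apply, ← sq]
    rfl
  rw [matrixNormalPDFReal, add_sub_cancel_right, htr]
  simp only [det_mul, det_transpose, Fintype.card_prod, Nat.cast_mul, ← abs_mul_abs_self P.det,
    ← abs_mul_abs_self W.det]
  -- The Jacobian powers of |det P| and |det W| cancel the determinant powers in the normal density,
  -- because det(P'P) = |det P|².
  have key : ∀ (x : ℝ) (c : ℕ), 0 < x → x ^ c * (x * x) ^ (-(c : ℝ) / 2) = 1 := by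
    intro x c hx
    rw [← sq, ← Real.rpow_natCast x 2, ← Real.rpow_mul hx.le, ← Real.rpow_natCast x c,
      ← Real.rpow_add hx]
    convert Real.rpow_zero x using 2
    push_cast; ring
  calc _ = (|P.det| ^ Fintype.card k * (|P.det| * |P.det|) ^ (-(Fintype.card k : ℝ) / 2)) *
        (|W.det| ^ Fintype.card m * (|W.det| * |W.det|) ^ (-(Fintype.card m : ℝ) / 2)) *
        ((2 * Real.pi) ^ (-((Fintype.card m : ℝ) * (Fintype.card k : ℝ)) / 2) *
          Real.exp (-(∑ p : k × m, (vecMeasurableEquiv m k Z) p ^ 2) / 2)) := by ring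
    _ = _ := by rw [key _ _ hPd, key _ _ hWd, mul_comm (Fintype.card m : ℝ)]; ring

theorem isProbabilityMeasure_matrixNormal (M : Matrix m k ℝ) {U : Matrix m m ℝ}
    {V : Matrix k k ℝ} (hU : U.PosDef) (hV : V.PosDef) :
    IsProbabilityMeasure (matrixNormal M U V) := by
  obtain ⟨P, rfl⟩ := hU.exists_transpose_mul_self
  obtain ⟨W, rfl⟩ := hV.exists_transpose_mul_self
  have hP : P.det ≠ 0 := fun h => by simpa [h] using hU.det_pos
  have hW : W.det ≠ 0 := fun h => by simpa [h] using hV.det_pos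
  rw [matrixNormal_eq_map M hP hW]
  have := (vecMeasurableEquiv m k).symm.measurable
  exact Measure.isProbabilityMeasure_map (Measurable.aemeasurable (by fun_prop))

/-- Each entry of M + P'ZW is affine in the standard Gaussians. The coefficient vectors are products
of a column of P and a column of W, so their inner product factors into an entry of P'P times an
entry of W'W. -/
theorem matrixNormal_second_moment (M : Matrix m k ℝ) {U : Matrix m m ℝ}
    {V : Matrix k k ℝ} (hU : U.PosDef) (hV : V.PosDef) (i j : m) (a b : k) :
    Integrable (fun X => X i a * X j b) (matrixNormal M U V) ∧
      ∫ X, X i a * X j b ∂(matrixNormal M U V) = M i a * M j b + U i j * V a b := by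
  obtain ⟨P, rfl⟩ := hU.exists_transpose_mul_self
  obtain ⟨W, rfl⟩ := hV.exists_transpose_mul_self
  have hP : P.det ≠ 0 := fun h => by simpa [h] using hU.det_pos
  have hW : W.det ≠ 0 := fun h => by simpa [h] using hV.det_pos
  rw [matrixNormal_eq_map M hP hW]
  have hv := (vecMeasurableEquiv m k).symm.measurable
  have hm : Measurable fun z => Pᵀ * (vecMeasurableEquiv m k).symm z * W + M := by fun_prop
  have hent : ∀ (i : m) (a : k) (z : k × m → ℝ),
      (Pᵀ * (vecMeasurableEquiv m k).symm z * W + M) i a =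
        M i a + ∑ p : k × m, (P p.2 i * W p.1 a) * z p := by
    intro i a z
    rw [Matrix.add_apply, add_comm, Fintype.sum_prod_type]
    simp only [Matrix.mul_apply, Matrix.transpose_apply, Finset.sum_mul]
    congr 1
    refine Finset.sum_congr rfl fun c _ => Finset.sum_congr rfl fun l _ => ?_
    change P l i * z (c, l) * W c a = _
    ring
  have hf : Measurable fun X : Matrix m k ℝ => X i a * X j b :=
    (measurable_matrix_entry i a).mul (measurable_matrix_entry j b)
  rw [integrable_map_measure hf.aestronglyMeasurable hm.aemeasurable,
    integral_map hm.aemeasurable hf.aestronglyMeasurable]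
  simp only [Function.comp_def, hent]
  refine ⟨(memLp_affine_pi_gaussianReal _ _).integrable_mul (memLp_affine_pi_gaussianReal _ _), ?_⟩
  rw [integral_affine_mul_affine_pi_gaussianReal]
  congr 1
  rw [Matrix.mul_apply, Matrix.mul_apply, Finset.sum_mul_sum, Fintype.sum_prod_type,
    Finset.sum_comm]
  refine Finset.sum_congr rfl fun c _ => Finset.sum_congr rfl fun l _ => ?_
  simp only [Matrix.transpose_apply]
  ring

end MatrixNormal

end

noncomputable section

/-! ### Inverse Wishart matrices: symmetries and block decomposition -/

section InverseWishart

set_option linter.unusedSectionVars false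

variable {ι κ : Type*} [Fintype ι] [DecidableEq ι] [Fintype κ] [DecidableEq κ]

/-- The unnormalized density of the inverse Wishart distribution on positive definite matrices. -/
def inverseWishartWeight (δ : ℝ) (D X : Matrix ι ι ℝ) : ℝ :=
  X.det ^ (-(δ + 2 * (Fintype.card ι : ℝ)) / 2) * Real.exp (-(D * X⁻¹).trace / 2)

/-- The unnormalized density of the inverse Wishart distribution. -/
def inverseWishartDensity (δ : ℝ) (D : Matrix ι ι ℝ) : Matrix ι ι ℝ → ENNReal :=
  {X : Matrix ι ι ℝ | X.PosDef}.indicator fun X => ENNReal.ofReal (inverseWishartWeight δ D X)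

theorem inverseWishartUnnormalized_eq (δ : ℝ) (D : Matrix ι ι ℝ) :
    inverseWishartUnnormalized δ D = (symmLebesgue ι).withDensity (inverseWishartDensity δ D) := rfl

theorem inverseWishartDensity_of_posDef (δ : ℝ) (D : Matrix ι ι ℝ) {X : Matrix ι ι ℝ}
    (hX : X.PosDef) :
    inverseWishartDensity δ D X = ENNReal.ofReal (inverseWishartWeight δ D X) :=
  Set.indicator_of_mem (s := {X : Matrix ι ι ℝ | X.PosDef}) hX _

theorem inverseWishartDensity_of_not_posDef (δ : ℝ) (D : Matrix ι ι ℝ) {X : Matrix ι ι ℝ}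
    (hX : ¬ X.PosDef) : inverseWishartDensity δ D X = 0 :=
  Set.indicator_of_notMem (s := {X : Matrix ι ι ℝ | X.PosDef}) hX _

theorem measurable_inverseWishartDensity (δ : ℝ) (D : Matrix ι ι ℝ) :
    Measurable (inverseWishartDensity δ D) := by
  refine Measurable.indicator ?_ measurableSet_posDef
  unfold inverseWishartWeight
  fun_prop

instance instSFiniteInverseWishartUnnormalized (δ : ℝ) (D : Matrix ι ι ℝ) :
    SFinite (inverseWishartUnnormalized δ D) := by
  rw [inverseWishartUnnormalized_eq]; infer_instance

theorem lintegral_inverseWishartUnnormalized (δ : ℝ) (D : Matrix ι ι ℝ)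
    {f : Matrix ι ι ℝ → ENNReal} (hf : Measurable f) :
    ∫⁻ X, f X ∂inverseWishartUnnormalized δ D =
      ∫⁻ X, inverseWishartDensity δ D X * f X ∂symmLebesgue ι := by
  rw [inverseWishartUnnormalized_eq,
    lintegral_withDensity_eq_lintegral_mul _ (measurable_inverseWishartDensity δ D) hf]
  rfl

theorem ae_posDef_inverseWishartUnnormalized (δ : ℝ) (D : Matrix ι ι ℝ) :
    ∀ᵐ X ∂inverseWishartUnnormalized δ D, X.PosDef := by
  rw [ae_iff]
  have hs : MeasurableSet {X : Matrix ι ι ℝ | ¬ X.PosDef} := measurableSet_posDef.compl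
  rw [inverseWishartUnnormalized_eq, withDensity_apply _ hs]
  refine (setLIntegral_congr_fun hs (g := 0) fun X hX => ?_).trans (by simp)
  exact inverseWishartDensity_of_not_posDef δ D hX

theorem ae_posDef_inverseWishart (δ : ℝ) (D : Matrix ι ι ℝ) :
    ∀ᵐ X ∂inverseWishart δ D, X.PosDef :=
  Measure.ae_smul_measure (ae_posDef_inverseWishartUnnormalized δ D) _

theorem isProbabilityMeasure_inverseWishart_iff (δ : ℝ) (D : Matrix ι ι ℝ) :
    IsProbabilityMeasure (inverseWishart δ D) ↔
      inverseWishartUnnormalized δ D Set.univ ≠ 0 ∧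
        inverseWishartUnnormalized δ D Set.univ ≠ ⊤ := by
  rw [isProbabilityMeasure_iff, inverseWishart, Measure.smul_apply, smul_eq_mul]
  constructor
  · intro h
    constructor <;> intro h' <;> rw [h'] at h <;> simp at h
  · rintro ⟨h1, h2⟩
    exact ENNReal.inv_mul_cancel h1 h2

theorem lintegral_inverseWishart (δ : ℝ) (D : Matrix ι ι ℝ) (f : Matrix ι ι ℝ → ENNReal) :
    ∫⁻ X, f X ∂inverseWishart δ D = (inverseWishartUnnormalized δ D Set.univ)⁻¹ *
      ∫⁻ X, f X ∂inverseWishartUnnormalized δ D := by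
  rw [inverseWishart, lintegral_smul_measure, smul_eq_mul]

/-- It suffices to compare unnormalised densities: a pushforward keeps the total mass, so the
normalising constants agree without being known or even finite. -/
theorem map_inverseWishart {δ δ' : ℝ} {D : Matrix ι ι ℝ} {D' : Matrix κ κ ℝ}
    {g : Matrix ι ι ℝ → Matrix κ κ ℝ} (hg : Measurable g)
    (hL : (symmLebesgue ι).map g = symmLebesgue κ)
    (hw : ∀ X, inverseWishartDensity δ' D' (g X) = inverseWishartDensity δ D X) :
    (inverseWishart δ D).map g = inverseWishart δ' D' := by
  have h : (inverseWishartUnnormalized δ D).map g = inverseWishartUnnormalized δ' D' := by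
    refine Measure.ext_of_lintegral _ fun f hf => ?_
    rw [lintegral_map hf hg, lintegral_inverseWishartUnnormalized _ _ (f := fun X => f (g X)) (hf.comp hg),
      lintegral_inverseWishartUnnormalized _ _ hf, ← hL,
      lintegral_map (f := fun X => inverseWishartDensity δ' D' X * f X)
        ((measurable_inverseWishartDensity δ' D').mul hf) hg]
    simp only [hw]
  rw [inverseWishart, inverseWishart, Measure.map_smul, h, ← h,
    Measure.map_apply hg MeasurableSet.univ, Set.preimage_univ]

/-- For orthogonal T, conjugation commutes with inversion and preserves determinants and traces, so
the density at TXT' for the scale TDT' equals the density at X for the scale D. -/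
theorem map_congruence_inverseWishart (δ : ℝ) (D : Matrix ι ι ℝ) {T : Matrix ι ι ℝ}
    (hT : Tᵀ * T = 1) :
    (inverseWishart δ D).map (fun X => T * X * Tᵀ) = inverseWishart δ (T * D * Tᵀ) := by
  have hT' : T * Tᵀ = 1 := mul_eq_one_comm.1 hT
  refine map_inverseWishart (by fun_prop) (map_congruence_symmLebesgue hT) fun X => ?_
  have hu : IsUnit T := IsUnit.of_mul_eq_one _ hT'
  have hpd : (T * X * Tᵀ).PosDef ↔ X.PosDef := by
    have := hu.posDef_star_right_conjugate_iff (x := X)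
    rwa [star_eq_conjTranspose, conjTranspose_eq_transpose_of_trivial] at this
  by_cases hX : X.PosDef
  · rw [inverseWishartDensity_of_posDef _ _ hX, inverseWishartDensity_of_posDef _ _ (hpd.2 hX),
      inverseWishartWeight, inverseWishartWeight]
    have hd : (T * X * Tᵀ).det = X.det := by
      rw [det_mul, det_mul, mul_right_comm, ← det_mul, hT', det_one, one_mul]
    have hi : (T * X * Tᵀ)⁻¹ = T * X⁻¹ * Tᵀ := by
      rw [Matrix.mul_inv_rev, Matrix.mul_inv_rev, inv_eq_left_inv hT, inv_eq_left_inv hT',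
        Matrix.mul_assoc]
    have ht : (T * D * Tᵀ * (T * X⁻¹ * Tᵀ)).trace = (D * X⁻¹).trace := by
      calc _ = (T * (D * (Tᵀ * T) * X⁻¹ * Tᵀ)).trace := by simp only [Matrix.mul_assoc]
        _ = _ := by rw [trace_mul_comm, hT, Matrix.mul_one, Matrix.mul_assoc _ Tᵀ T, hT,
            Matrix.mul_one]
    rw [hd, hi, ht]
  · rw [inverseWishartDensity_of_not_posDef _ _ hX,
      inverseWishartDensity_of_not_posDef _ _ (mt hpd.1 hX)]

theorem map_reindex_inverseWishart (δ : ℝ) (D : Matrix ι ι ℝ) (e : ι ≃ κ) :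
    (inverseWishart δ D).map (fun X => X.submatrix e.symm e.symm) =
      inverseWishart δ (D.submatrix e.symm e.symm) := by
  refine map_inverseWishart (by fun_prop) ?_ fun X => ?_
  · refine Measure.ext_of_lintegral _ fun f hf => ?_
    rw [lintegral_map hf (by fun_prop), lintegral_symmLebesgue_reindex e hf]
  · have hpd : (X.submatrix e.symm e.symm).PosDef ↔ X.PosDef := by
      refine ⟨fun h => ?_, fun h => h.submatrix e.symm.injective⟩
      simpa using h.submatrix e.injective
    by_cases hX : X.PosDef
    · rw [inverseWishartDensity_of_posDef _ _ hX, inverseWishartDensity_of_posDef _ _ (hpd.2 hX),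
        inverseWishartWeight, inverseWishartWeight, det_submatrix_equiv_self,
        inv_submatrix_equiv, submatrix_mul_equiv, Fintype.card_congr e]
      have ht : ((D * X⁻¹).submatrix e.symm e.symm).trace = (D * X⁻¹).trace :=
        e.symm.sum_comp fun i => (D * X⁻¹) i i
      rw [ht]
    · rw [inverseWishartDensity_of_not_posDef _ _ hX,
        inverseWishartDensity_of_not_posDef _ _ (mt hpd.1 hX)]

theorem Matrix.PosDef.transpose_eq {A : Matrix ι ι ℝ} (hA : A.PosDef) : Aᵀ = A := by
  rw [← conjTranspose_eq_transpose_of_trivial]; exact hA.isHermitian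

theorem trace_fromBlocks_eq_add (A : Matrix ι ι ℝ) (B : Matrix ι κ ℝ) (C : Matrix κ ι ℝ)
    (D : Matrix κ κ ℝ) : (fromBlocks A B C D).trace = A.trace + D.trace := by
  simp [Matrix.trace, Fintype.sum_sum_type]

/-- The symmetric block matrix with upper left block `A`, regression matrix `Y` of the lower on the
upper block, and Schur complement `P`. -/
def blockJoin (A : Matrix ι ι ℝ) (Y : Matrix κ ι ℝ) (P : Matrix κ κ ℝ) :
    Matrix (ι ⊕ κ) (ι ⊕ κ) ℝ :=
  fromBlocks A (Y * A)ᵀ (Y * A) (P + Y * A * Yᵀ)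

variable {A : Matrix ι ι ℝ} {P : Matrix κ κ ℝ}

theorem det_blockJoin (hA : A.PosDef) (Y : Matrix κ ι ℝ) (P : Matrix κ κ ℝ) :
    (blockJoin A Y P).det = A.det * P.det := by
  have hAt : Aᵀ = A := hA.transpose_eq
  have := hA.isUnit.invertible
  have h1 : A * A⁻¹ = 1 := mul_nonsing_inv _ ((isUnit_iff_isUnit_det A).1 hA.isUnit)
  rw [blockJoin, det_fromBlocks₁₁, invOf_eq_nonsing_inv, transpose_mul, hAt,
    Matrix.mul_assoc Y A A⁻¹, h1, Matrix.mul_one, Matrix.mul_assoc, add_sub_cancel_right]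

/-- The Schur complement criterion gives the semidefinite version; the factorisation det = det A ·
det P upgrades it to definiteness. -/
theorem posDef_blockJoin_iff (hA : A.PosDef) (Y : Matrix κ ι ℝ) (P : Matrix κ κ ℝ) :
    (blockJoin A Y P).PosDef ↔ P.PosDef := by
  have hAt : Aᵀ = A := hA.transpose_eq
  have := hA.isUnit.invertible
  have h1 : A * A⁻¹ = 1 := mul_nonsing_inv _ ((isUnit_iff_isUnit_det A).1 hA.isUnit)
  have h2 : (blockJoin A Y P).PosSemidef ↔ P.PosSemidef := by
    have h := PosDef.fromBlocks₁₁ (Y * A)ᵀ (P + Y * A * Yᵀ) hA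
    rw [conjTranspose_eq_transpose_of_trivial, transpose_transpose, transpose_mul, hAt,
      Matrix.mul_assoc Y A A⁻¹, h1, Matrix.mul_one, ← Matrix.mul_assoc, add_sub_cancel_right] at h
    rw [blockJoin, transpose_mul, hAt]
    exact h
  constructor
  · intro h
    refine ((h2.1 h.posSemidef).posDef_iff_det_ne_zero).2 fun h0 => ?_
    have := h.det_pos
    rw [det_blockJoin hA, h0, mul_zero] at this
    exact this.false
  · intro h
    refine ((h2.2 h.posSemidef).posDef_iff_det_ne_zero).2 ?_
    rw [det_blockJoin hA]
    exact (mul_pos hA.det_pos h.det_pos).ne'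

theorem inv_blockJoin (hA : A.PosDef) (Y : Matrix κ ι ℝ) (hP : P.PosDef) :
    (blockJoin A Y P)⁻¹ = fromBlocks (A⁻¹ + Yᵀ * P⁻¹ * Y) (-(Yᵀ * P⁻¹)) (-(P⁻¹ * Y)) P⁻¹ := by
  have hAt : Aᵀ = A := hA.transpose_eq
  have h1 : A * A⁻¹ = 1 := mul_nonsing_inv _ ((isUnit_iff_isUnit_det A).1 hA.isUnit)
  have h2 : P * P⁻¹ = 1 := mul_nonsing_inv _ ((isUnit_iff_isUnit_det P).1 hP.isUnit)
  refine inv_eq_right_inv ?_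
  rw [blockJoin, fromBlocks_multiply, ← fromBlocks_one, transpose_mul, hAt]
  simp only [Matrix.mul_add, Matrix.add_mul, Matrix.mul_neg, ← Matrix.mul_assoc, h1, h2,
    Matrix.mul_assoc Y A A⁻¹, Matrix.mul_one, Matrix.one_mul]
  congr 1 <;> abel

/-- Completing the square. The scale is written in the same block form, with M as regression matrix
and C as Schur complement, so the cross terms combine into a quadratic form in Y - M. -/
theorem trace_mul_inv_blockJoin (hA : A.PosDef) (Y : Matrix κ ι ℝ) (hP : P.PosDef)
    (D : Matrix ι ι ℝ) (M : Matrix κ ι ℝ) (C : Matrix κ κ ℝ) :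
    (fromBlocks D (D * Mᵀ) (M * D) (C + M * D * Mᵀ) * (blockJoin A Y P)⁻¹).trace =
      (D * A⁻¹).trace + (C * P⁻¹).trace + (D * (Y - M)ᵀ * P⁻¹ * (Y - M)).trace := by
  rw [inv_blockJoin hA Y hP, fromBlocks_multiply, trace_fromBlocks_eq_add]
  have e1 : (M * (D * (Yᵀ * P⁻¹))).trace = (D * (Yᵀ * (P⁻¹ * M))).trace := by
    rw [trace_mul_comm]; simp only [Matrix.mul_assoc]
  have e2 : (M * (D * (Mᵀ * P⁻¹))).trace = (D * (Mᵀ * (P⁻¹ * M))).trace := by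
    rw [trace_mul_comm]; simp only [Matrix.mul_assoc]
  simp only [Matrix.mul_add, Matrix.add_mul, Matrix.mul_neg, Matrix.mul_sub, Matrix.sub_mul,
    transpose_sub, trace_add, trace_sub, trace_neg, Matrix.mul_assoc, e1, e2]
  ring

/-- The exponents explain the degrees of freedom. The Jacobian power of |A| turns the exponent for
the large matrix into the one for the upper block. The exponent of |P| splits into the share
required by the normal density of Y and a remainder, which is an inverse Wishart exponent with `δ +
card ι` degrees of freedom. The prefactor undoes the part of the normal normalisation that does not
depend on P. -/
theorem blockWeight_eq (hA : A.PosDef) (Y : Matrix κ ι ℝ) (hP : P.PosDef) (δ : ℝ)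
    {D : Matrix ι ι ℝ} (hD : D.PosDef) (M : Matrix κ ι ℝ) (C : Matrix κ κ ℝ) :
    A.det ^ Fintype.card κ *
        inverseWishartWeight δ (fromBlocks D (D * Mᵀ) (M * D) (C + M * D * Mᵀ)) (blockJoin A Y P) =
      ((2 * Real.pi) ^ (((Fintype.card κ : ℝ) * (Fintype.card ι : ℝ)) / 2) *
        D⁻¹.det ^ ((Fintype.card κ : ℝ) / 2)) * (inverseWishartWeight δ D A *
          (inverseWishartWeight (δ + Fintype.card ι) C P * matrixNormalPDFReal M P D⁻¹ Y)) := by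
  have hD1 : (D⁻¹)⁻¹ = D := nonsing_inv_nonsing_inv _ ((isUnit_iff_isUnit_det D).1 hD.isUnit)
  have hDi : 0 < D⁻¹.det := hD.inv.det_pos
  have hAd := hA.det_pos
  have hPd := hP.det_pos
  have hpi : (0 : ℝ) < 2 * Real.pi := by positivity
  simp only [inverseWishartWeight, matrixNormalPDFReal, trace_mul_inv_blockJoin hA Y hP,
    det_blockJoin hA, hD1, Fintype.card_sum, Nat.cast_add]
  rw [Real.mul_rpow hAd.le hPd.le]
  have a1 : A.det ^ Fintype.card κ *
      A.det ^ (-(δ + 2 * ((Fintype.card ι : ℝ) + Fintype.card κ)) / 2) =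
      A.det ^ (-(δ + 2 * (Fintype.card ι : ℝ)) / 2) := by
    rw [← Real.rpow_natCast, ← Real.rpow_add hAd]; congr 1; ring
  have a2 : P.det ^ (-(δ + Fintype.card ι + 2 * (Fintype.card κ : ℝ)) / 2) *
      P.det ^ (-(Fintype.card ι : ℝ) / 2) =
      P.det ^ (-(δ + 2 * ((Fintype.card ι : ℝ) + Fintype.card κ)) / 2) := by
    rw [← Real.rpow_add hPd]; congr 1; ring
  have a3 : (2 * Real.pi) ^ (((Fintype.card κ : ℝ) * (Fintype.card ι : ℝ)) / 2) *
      (2 * Real.pi) ^ (-((Fintype.card κ : ℝ) * (Fintype.card ι : ℝ)) / 2) = 1 := by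
    rw [← Real.rpow_add hpi, neg_div, add_neg_cancel, Real.rpow_zero]
  have a4 : D⁻¹.det ^ ((Fintype.card κ : ℝ) / 2) * D⁻¹.det ^ (-(Fintype.card κ : ℝ) / 2) = 1 := by
    rw [← Real.rpow_add hDi, neg_div, add_neg_cancel, Real.rpow_zero]
  have a5 : Real.exp (-((D * A⁻¹).trace + (C * P⁻¹).trace +
      (D * (Y - M)ᵀ * P⁻¹ * (Y - M)).trace) / 2) = Real.exp (-(D * A⁻¹).trace / 2) *
      Real.exp (-(C * P⁻¹).trace / 2) *
      Real.exp (-(D * (Y - M)ᵀ * P⁻¹ * (Y - M)).trace / 2) := by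
    rw [← Real.exp_add, ← Real.exp_add]; congr 1; ring
  rw [a5]
  calc _ = (A.det ^ Fintype.card κ *
      A.det ^ (-(δ + 2 * ((Fintype.card ι : ℝ) + Fintype.card κ)) / 2)) *
      P.det ^ (-(δ + 2 * ((Fintype.card ι : ℝ) + Fintype.card κ)) / 2) *
      (Real.exp (-(D * A⁻¹).trace / 2) * Real.exp (-(C * P⁻¹).trace / 2) *
      Real.exp (-(D * (Y - M)ᵀ * P⁻¹ * (Y - M)).trace / 2)) := by ring
    _ = ((2 * Real.pi) ^ (((Fintype.card κ : ℝ) * (Fintype.card ι : ℝ)) / 2) *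
      (2 * Real.pi) ^ (-((Fintype.card κ : ℝ) * (Fintype.card ι : ℝ)) / 2)) *
      (D⁻¹.det ^ ((Fintype.card κ : ℝ) / 2) * D⁻¹.det ^ (-(Fintype.card κ : ℝ) / 2)) *
      A.det ^ (-(δ + 2 * (Fintype.card ι : ℝ)) / 2) *
      (P.det ^ (-(δ + Fintype.card ι + 2 * (Fintype.card κ : ℝ)) / 2) *
      P.det ^ (-(Fintype.card ι : ℝ) / 2)) *
      (Real.exp (-(D * A⁻¹).trace / 2) * Real.exp (-(C * P⁻¹).trace / 2) *
      Real.exp (-(D * (Y - M)ᵀ * P⁻¹ * (Y - M)).trace / 2)) := by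
        rw [a1, a2, a3, a4, one_mul, one_mul]
    _ = _ := by ring

/-- The matrix normal distribution `N(M, U, V)` as a kernel in the row covariance `U`, extended by a
point mass to matrices `U` which are not positive definite. -/
def matrixNormalKernel (M : Matrix κ ι ℝ) (V : Matrix ι ι ℝ) :
    Kernel (Matrix κ κ ℝ) (Matrix κ ι ℝ) :=
  open scoped Classical in
  Kernel.piecewise measurableSet_posDef
    (Kernel.withDensity (Kernel.const _ (matrixLebesgue κ ι)) fun U X =>
      ENNReal.ofReal (matrixNormalPDFReal M U V X)) (Kernel.const _ (Measure.dirac 0))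

theorem measurable_uncurry_matrixNormalPDFReal (M : Matrix κ ι ℝ) (V : Matrix ι ι ℝ) :
    Measurable (Function.uncurry fun (U : Matrix κ κ ℝ) X =>
      ENNReal.ofReal (matrixNormalPDFReal M U V X)) := by
  simp only [Function.uncurry_def, matrixNormalPDFReal]
  fun_prop

theorem matrixNormalKernel_apply (M : Matrix κ ι ℝ) (V : Matrix ι ι ℝ) (hP : P.PosDef) :
    matrixNormalKernel M V P = matrixNormal M P V := by
  classical
  rw [matrixNormalKernel, Kernel.piecewise_apply,
    if_pos (by exact hP), Kernel.withDensity_apply _ (measurable_uncurry_matrixNormalPDFReal M V),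
    Kernel.const_apply, matrixNormal_eq_withDensity]

theorem isMarkovKernel_matrixNormalKernel (M : Matrix κ ι ℝ) {V : Matrix ι ι ℝ} (hV : V.PosDef) :
    IsMarkovKernel (matrixNormalKernel M V) := by
  refine ⟨fun U => ?_⟩
  by_cases hU : U.PosDef
  · rw [matrixNormalKernel_apply M V hU]
    exact isProbabilityMeasure_matrixNormal M hU hV
  · classical
    rw [matrixNormalKernel, Kernel.piecewise_apply, if_neg (by exact hU), Kernel.const_apply]
    infer_instance

theorem measurable_blockJoin : Measurable fun p : Matrix ι ι ℝ × Matrix κ κ ℝ × Matrix κ ι ℝ =>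
    blockJoin p.1 p.2.2 p.2.1 := by
  unfold blockJoin
  fun_prop

/-- For fixed A, substitute B = YA, which produces the power of det A, and then translate the lower
block by the symmetric matrix YAY', which costs nothing. -/
theorem lintegral_lintegral_fromBlocks_eq_blockJoin (hA : A.PosDef)
    {g : Matrix (ι ⊕ κ) (ι ⊕ κ) ℝ → ENNReal} (hg : Measurable g) :
    ∫⁻ B, ∫⁻ G, g (fromBlocks A Bᵀ B G) ∂symmLebesgue κ ∂matrixLebesgue κ ι =
      ENNReal.ofReal (A.det ^ Fintype.card κ) *
        ∫⁻ P, ∫⁻ Y, g (blockJoin A Y P) ∂matrixLebesgue κ ι ∂symmLebesgue κ := by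
  have hAt : Aᵀ = A := hA.transpose_eq
  have hsplit : Measurable fun B : Matrix κ ι ℝ =>
      ∫⁻ G, g (fromBlocks A Bᵀ B G) ∂symmLebesgue κ :=
    Measurable.lintegral_prod_right' (f := fun q : Matrix κ ι ℝ × Matrix κ κ ℝ =>
      g (fromBlocks A q.1ᵀ q.1 q.2)) (by fun_prop)
  have hshift : ∀ Y : Matrix κ ι ℝ,
      ∫⁻ G, g (fromBlocks A ((1 : Matrix κ κ ℝ) * Y * A)ᵀ ((1 : Matrix κ κ ℝ) * Y * A) G)
        ∂symmLebesgue κ = ∫⁻ P, g (blockJoin A Y P) ∂symmLebesgue κ := by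
    intro Y
    rw [Matrix.one_mul, ← lintegral_symmLebesgue_add (A := Y * A * Yᵀ) (by fun_prop)
      (by simp only [transpose_mul, transpose_transpose, hAt, Matrix.mul_assoc])]
    rfl
  have hmA : Measurable fun q : Matrix κ ι ℝ × Matrix κ κ ℝ => g (blockJoin A q.1 q.2) :=
    hg.comp (measurable_blockJoin.comp
      (by fun_prop : Measurable fun q : Matrix κ ι ℝ × Matrix κ κ ℝ => (A, q.2, q.1)))
  rw [lintegral_mul_mul_matrixLebesgue (P := (1 : Matrix κ κ ℝ)) (W := A) (by simp) hA.det_pos.ne'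
    hsplit]
  simp_rw [hshift]
  rw [lintegral_lintegral_swap hmA.aemeasurable, det_one, abs_one, one_pow, one_mul,
    abs_of_pos hA.det_pos]

theorem density_mul_eq (hA : A.PosDef) (hP : P.PosDef) (δ : ℝ) {D : Matrix ι ι ℝ} (hD : D.PosDef)
    (M : Matrix κ ι ℝ) (C : Matrix κ κ ℝ) (Y : Matrix κ ι ℝ) :
    ENNReal.ofReal (A.det ^ Fintype.card κ) *
      inverseWishartDensity δ (fromBlocks D (D * Mᵀ) (M * D) (C + M * D * Mᵀ)) (blockJoin A Y P) =
    ENNReal.ofReal ((2 * Real.pi) ^ (((Fintype.card κ : ℝ) * (Fintype.card ι : ℝ)) / 2) *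
        D⁻¹.det ^ ((Fintype.card κ : ℝ) / 2)) * (inverseWishartDensity δ D A *
      (inverseWishartDensity (δ + Fintype.card ι) C P *
        ENNReal.ofReal (matrixNormalPDFReal M P D⁻¹ Y))) := by
  have hDi : 0 < D⁻¹.det := hD.inv.det_pos
  have hwA : 0 ≤ inverseWishartWeight δ D A :=
    mul_nonneg (Real.rpow_nonneg hA.det_pos.le _) (Real.exp_nonneg _)
  have hwP : 0 ≤ inverseWishartWeight (δ + Fintype.card ι) C P :=
    mul_nonneg (Real.rpow_nonneg hP.det_pos.le _) (Real.exp_nonneg _)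
  rw [inverseWishartDensity_of_posDef _ _ ((posDef_blockJoin_iff hA Y P).2 hP),
    inverseWishartDensity_of_posDef _ _ hA, inverseWishartDensity_of_posDef _ _ hP,
    ← ENNReal.ofReal_mul (pow_nonneg hA.det_pos.le _),
    blockWeight_eq hA Y hP δ hD M C, ENNReal.ofReal_mul (by positivity),
    ENNReal.ofReal_mul hwA, ENNReal.ofReal_mul hwP]

theorem lintegral_density_mul_blockJoin (hA : A.PosDef) (δ : ℝ) {D : Matrix ι ι ℝ} (hD : D.PosDef)
    (M : Matrix κ ι ℝ) (C : Matrix κ κ ℝ) (P : Matrix κ κ ℝ)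
    {f : Matrix (ι ⊕ κ) (ι ⊕ κ) ℝ → ENNReal} (hf : Measurable f) :
    ENNReal.ofReal (A.det ^ Fintype.card κ) * ∫⁻ Y, inverseWishartDensity δ
      (fromBlocks D (D * Mᵀ) (M * D) (C + M * D * Mᵀ)) (blockJoin A Y P) * f (blockJoin A Y P)
        ∂matrixLebesgue κ ι =
    ENNReal.ofReal ((2 * Real.pi) ^ (((Fintype.card κ : ℝ) * (Fintype.card ι : ℝ)) / 2) *
        D⁻¹.det ^ ((Fintype.card κ : ℝ) / 2)) * (inverseWishartDensity δ D A *
      (inverseWishartDensity (δ + Fintype.card ι) C P *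
        ∫⁻ Y, f (blockJoin A Y P) ∂matrixNormalKernel M D⁻¹ P)) := by
  by_cases hP : P.PosDef
  swap
  -- If P is not positive definite, neither is the joined matrix, and both sides vanish; the
  -- arbitrary value of the kernel there is harmless.
  · have h0 : ∀ Y : Matrix κ ι ℝ, inverseWishartDensity δ
        (fromBlocks D (D * Mᵀ) (M * D) (C + M * D * Mᵀ)) (blockJoin A Y P) = 0 := fun Y =>
      inverseWishartDensity_of_not_posDef _ _ (mt (posDef_blockJoin_iff hA Y P).1 hP)
    simp only [h0, inverseWishartDensity_of_not_posDef _ _ hP, zero_mul, lintegral_zero, mul_zero]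
  have hmAP : Measurable fun Y : Matrix κ ι ℝ => f (blockJoin A Y P) :=
    hf.comp (measurable_blockJoin.comp
      (by fun_prop : Measurable fun Y : Matrix κ ι ℝ => (A, P, Y)))
  have hAt : inverseWishartDensity δ D A ≠ ⊤ := by
    rw [inverseWishartDensity_of_posDef _ _ hA]; exact ENNReal.ofReal_ne_top
  have hPt : inverseWishartDensity (δ + Fintype.card ι) C P ≠ ⊤ := by
    rw [inverseWishartDensity_of_posDef _ _ hP]; exact ENNReal.ofReal_ne_top
  rw [matrixNormalKernel_apply _ _ hP, matrixNormal_eq_withDensity,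
    lintegral_withDensity_eq_lintegral_mul _
      (measurable_matrixNormalPDFReal M P D⁻¹).ennreal_ofReal hmAP,
    ← lintegral_const_mul' _ _ hPt, ← lintegral_const_mul' _ _ hAt,
    ← lintegral_const_mul' _ _ ENNReal.ofReal_ne_top,
    ← lintegral_const_mul' _ _ ENNReal.ofReal_ne_top]
  refine lintegral_congr fun Y => ?_
  rw [Pi.mul_apply, ← mul_assoc, density_mul_eq hA hP δ hD M C Y]
  ring

theorem lintegral_inverseWishartUnnormalized_fromBlocks (δ : ℝ) {D : Matrix ι ι ℝ} (hD : D.PosDef)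
    (M : Matrix κ ι ℝ) (C : Matrix κ κ ℝ) {f : Matrix (ι ⊕ κ) (ι ⊕ κ) ℝ → ENNReal}
    (hf : Measurable f) :
    ∫⁻ X, f X ∂inverseWishartUnnormalized δ (fromBlocks D (D * Mᵀ) (M * D) (C + M * D * Mᵀ)) =
      ENNReal.ofReal ((2 * Real.pi) ^ (((Fintype.card κ : ℝ) * (Fintype.card ι : ℝ)) / 2) *
        D⁻¹.det ^ ((Fintype.card κ : ℝ) / 2)) *
      ∫⁻ A, ∫⁻ P, ∫⁻ Y, f (blockJoin A Y P) ∂matrixNormalKernel M D⁻¹ P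
        ∂inverseWishartUnnormalized (δ + Fintype.card ι) C ∂inverseWishartUnnormalized δ D := by
  have := isMarkovKernel_matrixNormalKernel M hD.inv
  have hI1 : Measurable fun q : Matrix ι ι ℝ × Matrix κ κ ℝ =>
      ∫⁻ Y, f (blockJoin q.1 Y q.2) ∂matrixNormalKernel M D⁻¹ q.2 :=
    Measurable.lintegral_kernel_prod_right'
      (κ := Kernel.prodMkLeft (Matrix ι ι ℝ) (matrixNormalKernel M D⁻¹))
      (f := fun q : (Matrix ι ι ℝ × Matrix κ κ ℝ) × Matrix κ ι ℝ => f (blockJoin q.1.1 q.2 q.1.2))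
      (hf.comp (measurable_blockJoin.comp (by fun_prop : Measurable fun q : (Matrix ι ι ℝ ×
        Matrix κ κ ℝ) × Matrix κ ι ℝ => (q.1.1, q.1.2, q.2))))
  have hI2 : Measurable fun A : Matrix ι ι ℝ => ∫⁻ P, ∫⁻ Y, f (blockJoin A Y P)
      ∂matrixNormalKernel M D⁻¹ P ∂inverseWishartUnnormalized (δ + Fintype.card ι) C :=
    hI1.lintegral_prod_right'
  have hw := measurable_inverseWishartDensity δ (fromBlocks D (D * Mᵀ) (M * D) (C + M * D * Mᵀ))
  rw [lintegral_inverseWishartUnnormalized _ _ hf, lintegral_inverseWishartUnnormalized _ _ hI2,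
    lintegral_symmLebesgue_fromBlocks (f := fun X => inverseWishartDensity _ _ X * f X)
      (hw.mul hf), ← lintegral_const_mul' _ _ ENNReal.ofReal_ne_top]
  refine lintegral_congr fun A => ?_
  by_cases hA : A.PosDef
  swap
  · have h0 : ∀ (B : Matrix κ ι ℝ) (G : Matrix κ κ ℝ), inverseWishartDensity δ
        (fromBlocks D (D * Mᵀ) (M * D) (C + M * D * Mᵀ)) (fromBlocks A Bᵀ B G) = 0 := by
      intro B G
      -- A principal block of a positive definite matrix is positive definite, so the density
      -- vanishes over such A.
      refine inverseWishartDensity_of_not_posDef _ _ fun h => hA ?_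
      exact h.submatrix Sum.inl_injective
    simp only [h0, inverseWishartDensity_of_not_posDef _ _ hA, zero_mul, lintegral_zero, mul_zero]
  have hAt : inverseWishartDensity δ D A ≠ ⊤ := by
    rw [inverseWishartDensity_of_posDef _ _ hA]; exact ENNReal.ofReal_ne_top
  have hIA : Measurable fun P => ∫⁻ Y, f (blockJoin A Y P) ∂matrixNormalKernel M D⁻¹ P :=
    hI1.comp (measurable_prodMk_left (x := A))
  refine (lintegral_lintegral_fromBlocks_eq_blockJoin hA (hw.mul hf)).trans ?_
  rw [← lintegral_const_mul' _ _ ENNReal.ofReal_ne_top,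
    lintegral_inverseWishartUnnormalized _ _ hIA, ← lintegral_const_mul' _ _ hAt,
    ← lintegral_const_mul' _ _ ENNReal.ofReal_ne_top]
  exact lintegral_congr fun P => lintegral_density_mul_blockJoin hA δ hD M C P hf

/-- Block decomposition of an inverse Wishart matrix: the upper left block is inverse Wishart, and
independent of the Schur complement (inverse Wishart) and the regression matrix (matrix normal given
the Schur complement). -/
theorem inverseWishart_fromBlocks {δ : ℝ} {D : Matrix ι ι ℝ} (hD : D.PosDef)
    {M : Matrix κ ι ℝ} {C : Matrix κ κ ℝ} {Δ : Matrix (ι ⊕ κ) (ι ⊕ κ) ℝ}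
    (hΔ : Δ = fromBlocks D (D * Mᵀ) (M * D) (C + M * D * Mᵀ))
    (hprob : IsProbabilityMeasure (inverseWishart δ Δ)) :
    IsProbabilityMeasure (inverseWishart δ D) ∧
    IsProbabilityMeasure (inverseWishart (δ + Fintype.card ι) C) ∧
    inverseWishart δ Δ = ((inverseWishart δ D).prod
      (inverseWishart (δ + Fintype.card ι) C ⊗ₘ matrixNormalKernel M D⁻¹)).map
        fun p => blockJoin p.1 p.2.2 p.2.1 := by
  have hK := isMarkovKernel_matrixNormalKernel M hD.inv
  subst hΔ
  set c := ENNReal.ofReal ((2 * Real.pi) ^ (((Fintype.card κ : ℝ) * (Fintype.card ι : ℝ)) / 2) *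
        D⁻¹.det ^ ((Fintype.card κ : ℝ) / 2)) with hc
  have hDi : 0 < D⁻¹.det := hD.inv.det_pos
  have hc0 : c ≠ 0 := by rw [hc, ENNReal.ofReal_ne_zero_iff]; positivity
  have hct : c ≠ ⊤ := ENNReal.ofReal_ne_top
  obtain ⟨h0, ht⟩ := (isProbabilityMeasure_inverseWishart_iff _ _).1 hprob
  -- The test function 1 shows that the total mass is c·u·v, with u and v the masses of the two
  -- factors. As the product is neither 0 nor ⊤, neither are u and v, so both factors can be
  -- normalised.
  have hmass := lintegral_inverseWishartUnnormalized_fromBlocks δ hD M C (f := fun _ => 1)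
    measurable_const
  simp only [lintegral_const, measure_univ, mul_one, one_mul] at hmass
  rw [← hc, mul_comm (inverseWishartUnnormalized _ _ _)] at hmass
  rw [hmass] at h0 ht
  set u := inverseWishartUnnormalized δ D Set.univ with hu
  set v := inverseWishartUnnormalized (δ + Fintype.card ι) C Set.univ with hv
  have hu0 : u ≠ 0 := fun h => h0 (by simp [h])
  have hv0 : v ≠ 0 := fun h => h0 (by simp [h])
  have hut : u ≠ ⊤ := fun h => ht (by rw [h, ENNReal.top_mul hv0, ENNReal.mul_top hc0])
  have hvt : v ≠ ⊤ := fun h => ht (by rw [h, ENNReal.mul_top hu0, ENNReal.mul_top hc0])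
  have hp1 := (isProbabilityMeasure_inverseWishart_iff δ D).2 ⟨hu0, hut⟩
  have hp2 := (isProbabilityMeasure_inverseWishart_iff (δ + Fintype.card ι) C).2 ⟨hv0, hvt⟩
  refine ⟨hp1, hp2, ?_⟩
  have hm := measurable_blockJoin (ι := ι) (κ := κ)
  refine Measure.ext_of_lintegral _ fun f hf => ?_
  rw [lintegral_map hf hm, lintegral_prod _ (by exact (hf.comp hm).aemeasurable), lintegral_inverseWishart,
    lintegral_inverseWishart, lintegral_inverseWishartUnnormalized_fromBlocks δ hD M C hf, hmass]
  have hin : ∀ A : Matrix ι ι ℝ, ∫⁻ p, f (blockJoin A p.2 p.1)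
      ∂(inverseWishart (δ + Fintype.card ι) C ⊗ₘ matrixNormalKernel M D⁻¹) =
      v⁻¹ * ∫⁻ P, ∫⁻ Y, f (blockJoin A Y P) ∂matrixNormalKernel M D⁻¹ P
        ∂inverseWishartUnnormalized (δ + Fintype.card ι) C := by
    intro A
    rw [Measure.lintegral_compProd (f := fun p : Matrix κ κ ℝ × Matrix κ ι ℝ =>
      f (blockJoin A p.2 p.1)) (hf.comp (hm.comp measurable_prodMk_left)), lintegral_inverseWishart]
  simp_rw [hin]
  rw [lintegral_const_mul' _ _ (ENNReal.inv_ne_top.2 hv0), ← hu, ← hc,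
    ENNReal.mul_inv (Or.inl hc0) (Or.inl hct), ENNReal.mul_inv (Or.inl hu0) (Or.inl hut)]
  calc _ = (c⁻¹ * c) * (u⁻¹ * (v⁻¹ * ∫⁻ A, ∫⁻ P, ∫⁻ Y, f (blockJoin A Y P)
        ∂matrixNormalKernel M D⁻¹ P ∂inverseWishartUnnormalized (δ + Fintype.card ι) C
        ∂inverseWishartUnnormalized δ D)) := by ring
    _ = _ := by rw [ENNReal.inv_mul_cancel hc0 hct, one_mul]

end InverseWishart

end

noncomputable section

/-! ### The mean of an inverse Wishart matrix with diagonal scale -/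

section InverseGamma

/-- The substitution y = 1/x turns this into the Gamma integral. -/
theorem lintegral_rpow_mul_exp_neg_div {c s : ℝ} (hc : 0 < c) (hs : 0 < s) :
    ∫⁻ x in Set.Ioi (0 : ℝ), ENNReal.ofReal (x ^ (-s - 1) * Real.exp (-(c * x⁻¹))) =
      ENNReal.ofReal ((1 / c) ^ s * Real.Gamma s) := by
  have h1 := integral_comp_rpow_Ioi (fun y : ℝ => y ^ (s - 1) * Real.exp (-(c * y)))
    (p := -1) (by norm_num)
  rw [Real.integral_rpow_mul_exp_neg_mul_Ioi hs hc] at h1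
  have h2 : ∫ x in Set.Ioi (0 : ℝ), x ^ (-s - 1) * Real.exp (-(c * x⁻¹)) =
      (1 / c) ^ s * Real.Gamma s := by
    rw [← h1]
    refine setIntegral_congr_fun measurableSet_Ioi fun x hx => ?_
    have hx' : (0 : ℝ) < x := hx
    simp only [smul_eq_mul, Real.rpow_neg_one, abs_neg, abs_one, one_mul]
    rw [← mul_assoc, Real.inv_rpow hx'.le, ← Real.rpow_neg hx'.le, ← Real.rpow_add hx']
    congr 2
    ring
  have hpos : (0 : ℝ) < (1 / c) ^ s * Real.Gamma s := by
    have := Real.Gamma_pos_of_pos hs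
    positivity
  have hint : IntegrableOn (fun x : ℝ => x ^ (-s - 1) * Real.exp (-(c * x⁻¹))) (Set.Ioi 0) := by
    -- A non-integrable function would have Bochner integral 0, whereas the value just computed is
    -- positive.
    by_contra h
    rw [integral_undef h] at h2
    exact hpos.ne h2
  rw [← h2, ofReal_integral_eq_lintegral_ofReal hint]
  refine (ae_restrict_iff' measurableSet_Ioi).2 (Filter.Eventually.of_forall fun x hx => ?_)
  have hx' : (0 : ℝ) < x := hx
  simp only [Pi.zero_apply]
  positivity

end InverseGamma

/-! ### Marginals and mean of the inverse Wishart law. -/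

section Mean

variable {ι κ υ : Type*} [Fintype ι] [DecidableEq ι] [Fintype κ] [DecidableEq κ]

theorem lintegral_symmLebesgue_of_unique [Unique υ] [Fintype υ] [DecidableEq υ]
    {f : Matrix υ υ ℝ → ENNReal} (hf : Measurable f) :
    ∫⁻ X, f X ∂symmLebesgue υ = ∫⁻ x : ℝ, f (Matrix.of fun _ _ => x) := by
  -- A 1 × 1 symmetric matrix has a single coordinate, so the measure is Lebesgue measure on the
  -- line.
  let _ : Unique (Sym2 υ) := ⟨⟨s(default, default)⟩, fun s => by
    induction s with | _ i j => rw [Unique.eq_default i, Unique.eq_default j]; rfl⟩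
  rw [lintegral_symmLebesgue hf]
  have h0 : MeasurePreserving (MeasurableEquiv.funUnique (Sym2 υ) ℝ) volume volume := by
    convert volume_preserving_funUnique (Sym2 υ) ℝ
  have h := h0.symm
  refine (h.lintegral_comp (hf.comp measurable_symmMatrix)).symm.trans ?_
  rfl

theorem lintegral_inverseWishartUnnormalized_of_unique [Unique υ] [Fintype υ] [DecidableEq υ]
    (δ : ℝ) (D : Matrix υ υ ℝ) {f : ℝ → ENNReal} (hf : Measurable f) :
    ∫⁻ X, f (X default default) ∂inverseWishartUnnormalized δ D =
      ∫⁻ x in Set.Ioi (0 : ℝ), ENNReal.ofReal (x ^ (-(δ / 2) - 1) *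
        Real.exp (-(D default default / 2 * x⁻¹))) * f x := by
  have hf' : Measurable fun X : Matrix υ υ ℝ => f (X default default) :=
    hf.comp (measurable_matrix_entry _ _)
  rw [lintegral_inverseWishartUnnormalized _ _ hf', lintegral_symmLebesgue_of_unique
    (f := fun X => inverseWishartDensity δ D X * f (X default default))
    ((measurable_inverseWishartDensity δ D).mul hf'),
    ← lintegral_indicator measurableSet_Ioi]
  refine lintegral_congr fun x => ?_
  set X : Matrix υ υ ℝ := Matrix.of fun _ _ => x with hX
  have hd : X = diagonal fun _ => x := by
    ext i j; rw [Subsingleton.elim i j, hX]; simp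
  by_cases hx : 0 < x
  · have hpd : X.PosDef := by rw [hd]; exact Matrix.PosDef.diagonal fun _ => hx
    have hinv : X⁻¹ = diagonal fun _ => x⁻¹ := by
      refine inv_eq_right_inv ?_
      rw [hd, diagonal_mul_diagonal]
      simp [hx.ne']
    rw [Set.indicator_of_mem (Set.mem_Ioi.2 hx), inverseWishartDensity_of_posDef _ _ hpd,
      inverseWishartWeight, det_unique, hinv]
    have e1 : -(δ + 2 * (Fintype.card υ : ℝ)) / 2 = -(δ / 2) - 1 := by
      rw [Fintype.card_unique]; push_cast; ring
    have e2 : -(D * diagonal fun _ => x⁻¹).trace / 2 = -(D default default / 2 * x⁻¹) := by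
      simp only [Matrix.trace, Matrix.diag, Fintype.sum_unique, Matrix.mul_diagonal]
      ring
    rw [e1, e2]
    rfl
  · have hpd : ¬ X.PosDef := fun h => hx (by have := h.det_pos; rwa [det_unique] at this)
    rw [Set.indicator_of_notMem (by simpa using hx), inverseWishartDensity_of_not_posDef _ _ hpd,
      zero_mul]

/-- Multiplying the inverse gamma density by x lowers the shape from δ/2 to δ/2 - 1, which is
positive since δ > 2. The mean is the ratio of the two masses, and Γ(s + 1) = sΓ(s) evaluates it. -/
theorem inverseWishart_mean_of_unique [Unique υ] [Fintype υ] [DecidableEq υ]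
    {δ : ℝ} (hδ : 2 < δ) {D : Matrix υ υ ℝ} (hD : 0 < D default default) :
    Integrable (fun X : Matrix υ υ ℝ => X default default) (inverseWishart δ D) ∧
      ∫ X, X default default ∂inverseWishart δ D = D default default / (δ - 2) := by
  set d := D default default with hd
  have hm := measurable_matrix_entry (m := υ) (k := υ) default default
  have hpos : ∀ᵐ X ∂inverseWishart δ D, 0 ≤ X default default := by
    filter_upwards [ae_posDef_inverseWishart δ D] with X hX
    have := hX.det_pos
    rw [det_unique] at this
    exact this.le
  have hG : 0 < Real.Gamma (δ / 2 - 1) := Real.Gamma_pos_of_pos (by linarith)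
  have hmass : inverseWishartUnnormalized δ D Set.univ =
      ENNReal.ofReal ((1 / (d / 2)) ^ (δ / 2) * Real.Gamma (δ / 2)) := by
    rw [← lintegral_rpow_mul_exp_neg_div (by positivity) (by linarith)]
    have := lintegral_inverseWishartUnnormalized_of_unique δ D (f := fun _ => 1) measurable_const
    simpa using this
  have hmean : ∫⁻ X, ENNReal.ofReal (X default default) ∂inverseWishartUnnormalized δ D =
      ENNReal.ofReal ((1 / (d / 2)) ^ (δ / 2 - 1) * Real.Gamma (δ / 2 - 1)) := by
    rw [← lintegral_rpow_mul_exp_neg_div (by positivity) (by linarith),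
      lintegral_inverseWishartUnnormalized_of_unique δ D ENNReal.measurable_ofReal]
    refine setLIntegral_congr_fun measurableSet_Ioi fun x hx => ?_
    have hx' : (0 : ℝ) < x := hx
    rw [← ENNReal.ofReal_mul (by positivity), mul_right_comm, ← Real.rpow_add_one hx'.ne']
    congr 3
    ring
  have hratio : ∫⁻ X, ENNReal.ofReal (X default default) ∂inverseWishart δ D =
      ENNReal.ofReal (d / (δ - 2)) := by
    have hδ2 : (0 : ℝ) < δ / 2 - 1 := by linarith
    have hG2 : Real.Gamma (δ / 2) = (δ / 2 - 1) * Real.Gamma (δ / 2 - 1) := by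
      rw [← Real.Gamma_add_one hδ2.ne']; congr 1; ring
    have hpow : (1 / (d / 2)) ^ (δ / 2) = (1 / (d / 2)) ^ (δ / 2 - 1) * (1 / (d / 2)) := by
      rw [← Real.rpow_add_one (by positivity)]; congr 1; ring
    have hpp : 0 < (1 / (d / 2)) ^ (δ / 2 - 1) := by positivity
    rw [lintegral_inverseWishart, hmass, hmean, ← ENNReal.ofReal_inv_of_pos
      (by rw [hG2]; positivity), ← ENNReal.ofReal_mul (by rw [hG2]; positivity), hG2, hpow]
    congr 1
    have hG1 := hG.ne'
    generalize Real.Gamma (δ / 2 - 1) = g at hG1 ⊢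
    generalize (1 / (d / 2)) ^ (δ / 2 - 1) = y at hpp ⊢
    have h2 : δ / 2 - 1 ≠ 0 := hδ2.ne'
    have hd0 : d ≠ 0 := hD.ne'
    have hδ' : δ - 2 = 2 * (δ / 2 - 1) := by ring
    rw [hδ']
    generalize δ / 2 - 1 = z at h2 ⊢
    field_simp
  have hint : Integrable (fun X : Matrix υ υ ℝ => X default default) (inverseWishart δ D) := by
    refine ⟨hm.aestronglyMeasurable, ?_⟩
    rw [hasFiniteIntegral_iff_ofReal hpos, hratio]
    exact ENNReal.ofReal_lt_top
  refine ⟨hint, ?_⟩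
  rw [integral_eq_lintegral_of_nonneg_ae hpos hm.aestronglyMeasurable, hratio,
    ENNReal.toReal_ofReal (div_nonneg hD.le (by linarith))]

/-- In the block decomposition the upper left block is the first factor of a product of probability
measures. -/
theorem map_toBlocks₁₁_inverseWishart {δ : ℝ} {D : Matrix ι ι ℝ} (hD : D.PosDef)
    {M : Matrix κ ι ℝ} {C : Matrix κ κ ℝ} {Δ : Matrix (ι ⊕ κ) (ι ⊕ κ) ℝ}
    (hΔ : Δ = fromBlocks D (D * Mᵀ) (M * D) (C + M * D * Mᵀ))
    (hprob : IsProbabilityMeasure (inverseWishart δ Δ)) :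
    (inverseWishart δ Δ).map toBlocks₁₁ = inverseWishart δ D := by
  obtain ⟨h1, h2, h3⟩ := inverseWishart_fromBlocks hD hΔ hprob
  have hK := isMarkovKernel_matrixNormalKernel M hD.inv
  rw [h3, Measure.map_map (by fun_prop) measurable_blockJoin]
  have : (toBlocks₁₁ ∘ fun p : Matrix ι ι ℝ × Matrix κ κ ℝ × Matrix κ ι ℝ =>
      blockJoin p.1 p.2.2 p.2.1) = Prod.fst := by
    funext p
    simp [blockJoin]
  rw [this]
  exact (measurePreserving_fst).map_eq

theorem inverseWishart_diagonal_mean_diag {δ : ℝ} (hδ : 2 < δ) {d : ι → ℝ} (hd : ∀ i, 0 < d i)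
    (hprob : IsProbabilityMeasure (inverseWishart δ (diagonal d))) (i : ι) :
    Integrable (fun X : Matrix ι ι ℝ => X i i) (inverseWishart δ (diagonal d)) ∧
      ∫ X, X i i ∂inverseWishart δ (diagonal d) = d i / (δ - 2) := by
  -- Moving the index i into a block of its own makes the entry a 1 × 1 marginal. For a diagonal
  -- scale the regression matrix M is zero.
  let e : ι ≃ {j // j = i} ⊕ {j // ¬ j = i} := (Equiv.sumCompl (· = i)).symm
  have hg : Measurable fun X : Matrix ι ι ℝ => X.submatrix e.symm e.symm := by fun_prop
  have hsub : (diagonal d).submatrix e.symm e.symm = fromBlocks (diagonal fun j : {j // j = i} => d j)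
      ((diagonal fun j : {j // j = i} => d j) * (0 : Matrix {j // ¬ j = i} {j // j = i} ℝ)ᵀ)
      ((0 : Matrix {j // ¬ j = i} {j // j = i} ℝ) * (diagonal fun j : {j // j = i} => d j))
      ((diagonal fun j : {j // ¬ j = i} => d j) + (0 : Matrix {j // ¬ j = i} {j // j = i} ℝ) *
        (diagonal fun j : {j // j = i} => d j) * (0 : Matrix {j // ¬ j = i} {j // j = i} ℝ)ᵀ) := by
    rw [submatrix_diagonal_equiv]
    simp only [Matrix.transpose_zero, Matrix.mul_zero, Matrix.zero_mul, add_zero,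
      fromBlocks_diagonal]
    congr 1
    funext j
    rcases j with j | j <;> rfl
  have hmap := map_reindex_inverseWishart δ (diagonal d) e
  have hprob' : IsProbabilityMeasure (inverseWishart δ ((diagonal d).submatrix e.symm e.symm)) := by
    rw [← hmap]; exact Measure.isProbabilityMeasure_map hg.aemeasurable
  have hpd : (diagonal fun j : {j // j = i} => d j).PosDef := Matrix.PosDef.diagonal fun j => hd j
  have hm2 := map_toBlocks₁₁_inverseWishart hpd hsub hprob'
  rw [← hmap, Measure.map_map (by fun_prop) hg] at hm2
  obtain ⟨h1, h2⟩ := inverseWishart_mean_of_unique hδ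
    (D := diagonal fun j : {j // j = i} => d j) (by simpa using hd _)
  have hg2 : Measurable (toBlocks₁₁ ∘ fun X : Matrix ι ι ℝ => X.submatrix e.symm e.symm) :=
    (measurable_id.matrix_toBlocks₁₁).comp hg
  have hent := measurable_matrix_entry (m := {j // j = i}) (k := {j // j = i}) default default
  rw [← hm2] at h1 h2
  rw [integrable_map_measure hent.aestronglyMeasurable hg2.aemeasurable] at h1
  rw [integral_map hg2.aemeasurable hent.aestronglyMeasurable, diagonal_apply_eq] at h2
  exact ⟨h1, h2⟩

theorem Matrix.PosDef.abs_entry_le {X : Matrix ι ι ℝ} (hX : X.PosDef) (i j : ι) :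
    |X i j| ≤ X i i + X j j := by
  have hs : X j i = X i j := congrFun (congrFun hX.transpose_eq i) j
  have hi : 0 < X i i := hX.diag_pos
  have hj : 0 < X j j := hX.diag_pos
  have key : ∀ c : ℝ, 0 ≤ X i i + c * X i j + c * X j i + c ^ 2 * X j j := by
    intro c
    -- The quadratic form is tested on eᵢ + c eⱼ, later with c = 1 and c = -1.
    have h := hX.posSemidef.dotProduct_mulVec_nonneg (Pi.single i 1 + Pi.single j c)
    simp only [star_trivial, mulVec_add, dotProduct_add, add_dotProduct, mulVec_single,
      single_dotProduct] at h
    simp only [Pi.smul_apply, MulOpposite.smul_eq_mul_unop, col_apply, MulOpposite.unop_op] at h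
    linarith
  have h1 := key 1
  have h2 := key (-1)
  rw [abs_le]
  constructor <;> nlinarith

theorem inverseWishart_diagonal_mean {δ : ℝ} (hδ : 2 < δ) {d : ι → ℝ} (hd : ∀ i, 0 < d i)
    (hprob : IsProbabilityMeasure (inverseWishart δ (diagonal d))) (i j : ι) :
    Integrable (fun X : Matrix ι ι ℝ => X i j) (inverseWishart δ (diagonal d)) ∧
      ∫ X, X i j ∂inverseWishart δ (diagonal d) = diagonal d i j / (δ - 2) := by
  have hm := measurable_matrix_entry i j
  have hint : Integrable (fun X : Matrix ι ι ℝ => X i j) (inverseWishart δ (diagonal d)) := by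
    refine ((inverseWishart_diagonal_mean_diag hδ hd hprob i).1.add
      (inverseWishart_diagonal_mean_diag hδ hd hprob j).1).mono' hm.aestronglyMeasurable ?_
    filter_upwards [ae_posDef_inverseWishart δ (diagonal d)] with X hX
    exact hX.abs_entry_le i j
  refine ⟨hint, ?_⟩
  by_cases hij : i = j
  · subst hij
    rw [diagonal_apply_eq]
    exact (inverseWishart_diagonal_mean_diag hδ hd hprob i).2
  rw [diagonal_apply_ne _ hij, zero_div]
  -- Flipping the sign of coordinate i is an orthogonal congruence that fixes a diagonal scale,
  -- hence the law, but negates the entry (i, j). Its mean is therefore zero.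
  set s : ι → ℝ := fun k => if k = i then -1 else 1 with hs
  have hss : ∀ k, s k * s k = 1 := fun k => by by_cases h : k = i <;> simp [hs, h]
  have hT : (diagonal s)ᵀ * diagonal s = 1 := by
    rw [diagonal_transpose, diagonal_mul_diagonal]
    simp [hss]
  have hinv := map_congruence_inverseWishart δ (diagonal d) hT
  have hD : diagonal s * diagonal d * (diagonal s)ᵀ = diagonal d := by
    rw [diagonal_transpose, diagonal_mul_diagonal, diagonal_mul_diagonal]
    congr 1
    funext k
    rw [mul_right_comm, hss, one_mul]
  rw [hD] at hinv
  have h1 : ∫ X, X i j ∂inverseWishart δ (diagonal d) =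
      ∫ X, -X i j ∂inverseWishart δ (diagonal d) := by
    conv_lhs => rw [← hinv]
    rw [integral_map (Measurable.aemeasurable (by fun_prop)) hm.aestronglyMeasurable]
    refine integral_congr_ae (Filter.Eventually.of_forall fun X => ?_)
    simp only [diagonal_transpose, mul_diagonal, diagonal_mul]
    simp [hs, Ne.symm hij]
  rw [integral_neg] at h1
  linarith

end Mean

end

noncomputable section

/-! ### Markov transitions driven by independent innovations -/

section Markov

variable {Ω α β γ : Type*} {m m0 : MeasurableSpace Ω} [MeasurableSpace α] [MeasurableSpace β]
  [MeasurableSpace γ]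

/-- The transition kernel `a ↦ law of g (a, p)`, where `p` has law `τ`. -/
def innovationKernel (τ : Measure γ) (g : α × γ → β) : Kernel α β :=
  (Kernel.id ×ₖ Kernel.const α τ).map g

theorem innovationKernel_apply (τ : Measure γ) [SFinite τ] {g : α × γ → β} (hg : Measurable g)
    (a : α) : innovationKernel τ g a = τ.map fun p => g (a, p) := by
  rw [innovationKernel, Kernel.map_apply _ hg, Kernel.prod_apply, Kernel.id_apply,
    Kernel.const_apply, Measure.dirac_prod, Measure.map_map hg measurable_prodMk_left]
  rfl

theorem isMarkovKernel_innovationKernel (τ : Measure γ) [IsProbabilityMeasure τ] {g : α × γ → β}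
    (hg : Measurable g) : IsMarkovKernel (innovationKernel τ g) := by
  refine ⟨fun a => ?_⟩
  rw [innovationKernel_apply τ hg]
  exact Measure.isProbabilityMeasure_map (hg.comp measurable_prodMk_left).aemeasurable

theorem compProd_innovationKernel (ν : Measure α) [SFinite ν] (τ : Measure γ)
    [IsProbabilityMeasure τ] {g : α × γ → β} (hg : Measurable g) :
    ν ⊗ₘ innovationKernel τ g = (ν.prod τ).map fun q => (q.1, g q) := by
  have := isMarkovKernel_innovationKernel τ hg
  refine Measure.ext_of_lintegral _ fun f hf => ?_
  rw [Measure.lintegral_compProd hf, lintegral_map hf (by fun_prop),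
    lintegral_prod _ (by exact (hf.comp (by fun_prop)).aemeasurable)]
  refine lintegral_congr fun a => ?_
  rw [innovationKernel_apply τ hg, lintegral_map (by fun_prop) (by fun_prop)]

variable {μ : Measure Ω} [IsProbabilityMeasure μ] {X : Ω → α} {Y : Ω → β}
  {κ : Kernel α β} [IsMarkovKernel κ]

/-- If `κ` is the conditional law of `Y` given `X`, and `Y` depends on `m` only through `X`, then
`κ` is the conditional law on every event of `m`. -/
theorem map_restrict_eq_compProd_of_markov [StandardBorelSpace β] [Nonempty β]
    (hm : m ≤ m0) (hX : Measurable[m] X) (hY : Measurable Y)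
    (hlaw : μ.map (fun ω => (X ω, Y ω)) = μ.map X ⊗ₘ κ)
    (hM : ∀ B, MeasurableSet B →
      μ⟦Y ⁻¹' B | m⟧ =ᵐ[μ] μ⟦Y ⁻¹' B | MeasurableSpace.comap X inferInstance⟧)
    {G : Set Ω} (hG : MeasurableSet[m] G) :
    (μ.restrict G).map (fun ω => (X ω, Y ω)) = (μ.restrict G).map X ⊗ₘ κ := by
  have hX0 : Measurable X := hX.mono hm le_rfl
  refine Measure.ext_prod fun {s t} hs ht => ?_
  have hsG : MeasurableSet[m] (X ⁻¹' s ∩ G) := (hX hs).inter hG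
  -- By the Markov hypothesis, conditioning on `m` amounts to conditioning on X, and uniqueness of
  -- disintegrations identifies that conditional law with `κ`.
  have hce : μ⟦Y ⁻¹' t | m⟧ =ᵐ[μ] fun ω => (κ (X ω)).real t := by
    refine (hM t ht).trans ?_
    refine (condDistrib_ae_eq_condExp hX0 hY ht).symm.trans ?_
    have := condDistrib_ae_eq_of_measure_eq_compProd X hY.aemeasurable hlaw
    filter_upwards [ae_of_ae_map hX0.aemeasurable this] with ω hω
    rw [hω]
  have hκ : Measurable fun ω => κ (X ω) t := (κ.measurable_coe ht).comp hX0
  rw [Measure.map_apply (by fun_prop) (hs.prod ht), Measure.compProd_apply_prod hs ht,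
    setLIntegral_map hs (κ.measurable_coe ht) hX0, Measure.restrict_restrict (hX0 hs),
    Measure.restrict_apply ((by fun_prop : Measurable fun ω => (X ω, Y ω)) (hs.prod ht))]
  have hset : (fun ω => (X ω, Y ω)) ⁻¹' s ×ˢ t ∩ G = Y ⁻¹' t ∩ (X ⁻¹' s ∩ G) := by
    ext ω; simp only [Set.mem_inter_iff, Set.mem_preimage, Set.mem_prod]; tauto
  have h1 : μ.real (Y ⁻¹' t ∩ (X ⁻¹' s ∩ G)) = ∫ ω in X ⁻¹' s ∩ G, (κ (X ω)).real t ∂μ := by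
    rw [← setIntegral_congr_ae (hm _ hsG) (hce.mono fun ω h _ => h),
      setIntegral_condExp hm ((integrable_const 1).indicator (hY ht)) hsG,
      setIntegral_indicator (hY ht), setIntegral_const, smul_eq_mul, mul_one, Set.inter_comm]
  rw [hset, ← ENNReal.ofReal_toReal (measure_ne_top μ _), ← Measure.real, h1,
    ofReal_integral_eq_lintegral_ofReal]
  · refine lintegral_congr fun ω => ?_
    exact ENNReal.ofReal_toReal (measure_ne_top _ _)
  · refine Integrable.of_bound hκ.ennreal_toReal.aestronglyMeasurable 1
      (Filter.Eventually.of_forall fun ω => ?_)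
    rw [Real.norm_eq_abs, abs_of_nonneg measureReal_nonneg]
    exact measureReal_le_one
  · exact Filter.Eventually.of_forall fun ω => ENNReal.toReal_nonneg

/-- The disintegration holds after restriction to every event of `m`, so the kernel integral has the
set integrals that characterise the conditional expectation. -/
theorem condExp_comp_eq_integral_of_markov [StandardBorelSpace β] [Nonempty β]
    (hm : m ≤ m0) (hX : Measurable[m] X) (hY : Measurable Y)
    (hlaw : μ.map (fun ω => (X ω, Y ω)) = μ.map X ⊗ₘ κ)
    (hM : ∀ B, MeasurableSet B →
      μ⟦Y ⁻¹' B | m⟧ =ᵐ[μ] μ⟦Y ⁻¹' B | MeasurableSpace.comap X inferInstance⟧)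
    {f : β → ℝ} (hf : Measurable f) (hfY : Integrable (fun ω => f (Y ω)) μ) :
    μ[fun ω => f (Y ω) | m] =ᵐ[μ] fun ω => ∫ y, f y ∂κ (X ω) := by
  have hX0 : Measurable X := hX.mono hm le_rfl
  have hXY : Measurable fun ω => (X ω, Y ω) := by fun_prop
  have hf2 : Measurable fun q : α × β => f q.2 := hf.comp measurable_snd
  have hsm : StronglyMeasurable fun a => ∫ y, f y ∂κ a :=
    (hf.stronglyMeasurable.comp_measurable measurable_snd).integral_kernel_prod_right'
      (κ := κ) (f := fun q : α × β => f q.2)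
  have hfst : ∀ G, MeasurableSet[m] G → Integrable (fun q : α × β => f q.2)
      ((μ.restrict G).map X ⊗ₘ κ) := by
    intro G hG
    rw [← map_restrict_eq_compProd_of_markov hm hX hY hlaw hM hG,
      integrable_map_measure hf2.aestronglyMeasurable hXY.aemeasurable]
    exact hfY.integrableOn
  have hint : ∀ G, MeasurableSet[m] G →
      IntegrableOn (fun ω => ∫ y, f y ∂κ (X ω)) G μ := by
    intro G hG
    have h1 := ((Measure.integrable_compProd_iff hf2.aestronglyMeasurable).1 (hfst G hG)).2
    have h2 : Integrable (fun a => ∫ y, f y ∂κ a) ((μ.restrict G).map X) :=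
      h1.mono' hsm.aestronglyMeasurable
        (Filter.Eventually.of_forall fun a => norm_integral_le_integral_norm _)
    exact h2.comp_measurable hX0
  refine (ae_eq_condExp_of_forall_setIntegral_eq hm hfY (fun G hG _ => hint G hG) ?_ ?_).symm
  · intro G hG _
    have h1 : ∫ ω in G, f (Y ω) ∂μ = ∫ q, f q.2 ∂((μ.restrict G).map fun ω => (X ω, Y ω)) := by
      rw [integral_map hXY.aemeasurable hf2.aestronglyMeasurable]
    rw [h1, map_restrict_eq_compProd_of_markov hm hX hY hlaw hM hG,
      Measure.integral_compProd (hfst G hG),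
      integral_map hX0.aemeasurable hsm.aestronglyMeasurable]
  · exact (hsm.comp_measurable hX).aestronglyMeasurable

/-- An innovation `h (X, Y)` recovered from a transition `Y = g (X, p)` is independent of the past,
with the law of `p`. -/
theorem map_restrict_innovation [StandardBorelSpace β] [Nonempty β] {τ : Measure γ}
    [IsProbabilityMeasure τ] {g : α × γ → β} (hg : Measurable g)
    (hm : m ≤ m0) (hX : Measurable[m] X) (hY : Measurable Y)
    (hlaw : μ.map (fun ω => (X ω, Y ω)) = (μ.map X ⊗ₘ innovationKernel τ g))
    (hM : ∀ B, MeasurableSet B →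
      μ⟦Y ⁻¹' B | m⟧ =ᵐ[μ] μ⟦Y ⁻¹' B | MeasurableSpace.comap X inferInstance⟧)
    {h : α × β → γ} (hh : Measurable h) (hinv : ∀ᵐ ω ∂μ, ∀ p, h (X ω, g (X ω, p)) = p)
    {G : Set Ω} (hG : MeasurableSet[m] G) {C : Set γ} (hC : MeasurableSet C) :
    μ (((fun ω => h (X ω, Y ω)) ⁻¹' C) ∩ G) = τ C * μ G := by
  have := isMarkovKernel_innovationKernel τ hg
  have hX0 : Measurable X := hX.mono hm le_rfl
  have h1 := map_restrict_eq_compProd_of_markov hm hX hY hlaw hM hG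
  have hXY : Measurable fun ω => (X ω, Y ω) := by fun_prop
  have h2 := congrArg (fun ν => ν (h ⁻¹' C)) h1
  rw [Measure.map_apply hXY (hh hC), Measure.restrict_apply (hXY (hh hC)),
    Measure.compProd_apply (hh hC),
    lintegral_map (Kernel.measurable_kernel_prodMk_left (hh hC)) hX0] at h2
  refine Eq.trans h2 ?_
  -- Since h(X, ·) undoes g(X, ·), the kernel gives the set of outcomes with innovation in C the
  -- mass τ(C), whatever the value of X. This constancy is the independence.
  have h3 : ∀ᵐ ω ∂μ.restrict G,
      innovationKernel τ g (X ω) (Prod.mk (X ω) ⁻¹' (h ⁻¹' C)) = τ C := by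
    filter_upwards [ae_restrict_of_ae hinv] with ω hω
    rw [innovationKernel_apply τ hg, Measure.map_apply (by fun_prop)
      (measurable_prodMk_left (hh hC))]
    congr 1
    ext p
    simp [hω p]
  rw [lintegral_congr_ae h3, lintegral_const, Measure.restrict_apply_univ]

end Markov

end

noncomputable section

/-! ### The law of the innovations -/

section InnovationLaw

set_option linter.unusedSectionVars false

variable {ι κ : Type*} [Fintype ι] [DecidableEq ι] [Fintype κ] [DecidableEq κ]

/-- The joint law of the innovations `(Ψ, Υ)`: `Ψ ∼ IW(δ, C)` and `Υ ∣ Ψ ∼ N(M, Ψ, V)`. -/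
def innovationLaw (δ : ℝ) (C : Matrix κ κ ℝ) (M : Matrix κ ι ℝ) (V : Matrix ι ι ℝ) :
    Measure (Matrix κ κ ℝ × Matrix κ ι ℝ) :=
  inverseWishart δ C ⊗ₘ matrixNormalKernel M V

/-- The new state `Ψ + Υ A Υ'`. -/
def nextState (p : Matrix ι ι ℝ × Matrix κ κ ℝ × Matrix κ ι ℝ) : Matrix κ κ ℝ :=
  p.2.1 + p.2.2 * p.1 * p.2.2ᵀ

theorem measurable_nextState : Measurable (nextState (ι := ι) (κ := κ)) := by
  unfold nextState; fun_prop

variable {δ : ℝ} {M : Matrix κ ι ℝ} {V : Matrix ι ι ℝ}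

theorem isProbabilityMeasure_innovationLaw {C : Matrix κ κ ℝ} (hV : V.PosDef)
    (hprob : IsProbabilityMeasure (inverseWishart δ C)) :
    IsProbabilityMeasure (innovationLaw δ C M V) := by
  have := isMarkovKernel_matrixNormalKernel M hV
  unfold innovationLaw
  infer_instance

theorem map_fst_innovationLaw {C : Matrix κ κ ℝ} (hV : V.PosDef)
    (hprob : IsProbabilityMeasure (inverseWishart δ C)) :
    (innovationLaw δ C M V).map Prod.fst = inverseWishart δ C := by
  have := isMarkovKernel_matrixNormalKernel M hV
  exact Measure.fst_compProd _ _

variable {c : κ → ℝ}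

theorem innovationLaw_fst_mean (hδ : 2 < δ) (hc : ∀ i, 0 < c i) (hV : V.PosDef)
    (hprob : IsProbabilityMeasure (inverseWishart δ (diagonal c))) (i j : κ) :
    Integrable (fun p => p.1 i j) (innovationLaw δ (diagonal c) M V) ∧
      ∫ p, p.1 i j ∂innovationLaw δ (diagonal c) M V = diagonal c i j / (δ - 2) := by
  obtain ⟨h1, h2⟩ := inverseWishart_diagonal_mean hδ hc hprob i j
  have hm := (measurable_matrix_entry i j).aestronglyMeasurable
    (μ := inverseWishart δ (diagonal c))
  rw [← map_fst_innovationLaw (M := M) hV hprob] at h1 h2 hm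
  rw [integrable_map_measure hm measurable_fst.aemeasurable] at h1
  rw [integral_map measurable_fst.aemeasurable hm] at h2
  exact ⟨h1, h2⟩

/-- Given Ψ = P, the second moment of the entry is affine in the diagonal entry of P, which is
integrable because the inverse Wishart mean exists. -/
theorem innovationLaw_snd_memLp (hδ : 2 < δ) (hc : ∀ i, 0 < c i) (hV : V.PosDef)
    (hprob : IsProbabilityMeasure (inverseWishart δ (diagonal c))) (i : κ) (a : ι) :
    MemLp (fun p => p.2 i a) 2 (innovationLaw δ (diagonal c) M V) := by
  have hK := isMarkovKernel_matrixNormalKernel M hV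
  have hm : Measurable fun p : Matrix κ κ ℝ × Matrix κ ι ℝ => p.2 i a :=
    (measurable_matrix_entry i a).comp measurable_snd
  rw [memLp_two_iff_integrable_sq hm.aestronglyMeasurable, innovationLaw,
    Measure.integrable_compProd_iff (hm.pow_const 2).aestronglyMeasurable]
  have hae := ae_posDef_inverseWishart δ (diagonal c)
  constructor
  · filter_upwards [hae] with P hP
    rw [matrixNormalKernel_apply _ _ hP]
    simpa only [sq] using (matrixNormal_second_moment M hP hV i i a a).1
  · have h1 : Integrable (fun P : Matrix κ κ ℝ => M i a * M i a + P i i * V a a)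
        (inverseWishart δ (diagonal c)) :=
      (integrable_const _).add ((inverseWishart_diagonal_mean hδ hc hprob i i).1.mul_const _)
    refine h1.congr ?_
    filter_upwards [hae] with P hP
    rw [matrixNormalKernel_apply _ _ hP, ← (matrixNormal_second_moment M hP hV i i a a).2]
    refine integral_congr_ae (Filter.Eventually.of_forall fun Y => ?_)
    simp only [Real.norm_eq_abs, sq]
    exact (abs_mul_self _).symm

theorem innovationLaw_snd_second_moment (hδ : 2 < δ) (hc : ∀ i, 0 < c i) (hV : V.PosDef)
    (hprob : IsProbabilityMeasure (inverseWishart δ (diagonal c))) (i j : κ) (a b : ι) :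
    Integrable (fun p => p.2 i a * p.2 j b) (innovationLaw δ (diagonal c) M V) ∧
      ∫ p, p.2 i a * p.2 j b ∂innovationLaw δ (diagonal c) M V =
        M i a * M j b + diagonal c i j / (δ - 2) * V a b := by
  have hK := isMarkovKernel_matrixNormalKernel M hV
  have hint : Integrable (fun p => p.2 i a * p.2 j b) (innovationLaw δ (diagonal c) M V) :=
    (innovationLaw_snd_memLp hδ hc hV hprob i a).integrable_mul
      (innovationLaw_snd_memLp hδ hc hV hprob j b)
  refine ⟨hint, ?_⟩
  have h1 := inverseWishart_diagonal_mean hδ hc hprob i j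
  rw [innovationLaw, Measure.integral_compProd hint]
  calc _ = ∫ P, (M i a * M j b + P i j * V a b) ∂inverseWishart δ (diagonal c) := by
        refine integral_congr_ae ?_
        filter_upwards [ae_posDef_inverseWishart δ (diagonal c)] with P hP
        rw [matrixNormalKernel_apply _ _ hP]
        exact (matrixNormal_second_moment M hP hV i j a b).2
    _ = _ := by
        rw [integral_add (integrable_const _) (h1.1.mul_const _)]
        refine congrArg₂ (· + ·) (by simp) ?_
        rw [integral_mul_const, h1.2]

/-- Averaging the quadratic form ΥAΥ' gives MAM' plus E[Ψ] times the sum of the products of entries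
of A and V. The summand 1 in the last factor is the contribution of Ψ itself. -/
theorem integral_nextState (hδ : 2 < δ) (hc : ∀ i, 0 < c i) (hV : V.PosDef)
    (hprob : IsProbabilityMeasure (inverseWishart δ (diagonal c))) (A : Matrix ι ι ℝ) (i j : κ) :
    ∫ p, nextState (A, p) i j ∂innovationLaw δ (diagonal c) M V =
      (M * A * Mᵀ) i j + diagonal c i j / (δ - 2) * (1 + ∑ a, ∑ b, A a b * V a b) := by
  have h1 := innovationLaw_fst_mean (M := M) hδ hc hV hprob i j
  have h2 := innovationLaw_snd_second_moment (M := M) hδ hc hV hprob i j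
  have hexp : ∀ p : Matrix κ κ ℝ × Matrix κ ι ℝ, nextState (A, p) i j =
      p.1 i j + ∑ a, ∑ b, A a b * (p.2 i a * p.2 j b) := by
    intro p
    simp only [nextState, Matrix.add_apply, Matrix.mul_apply, Matrix.transpose_apply,
      Finset.sum_mul]
    rw [Finset.sum_comm]
    congr 1
    exact Finset.sum_congr rfl fun a _ => Finset.sum_congr rfl fun b _ => by ring
  simp_rw [hexp]
  have hin : ∀ a, Integrable (fun p => ∑ b, A a b * (p.2 i a * p.2 j b))
      (innovationLaw δ (diagonal c) M V) :=
    fun a => integrable_finsetSum _ fun b _ => (h2 a b).1.const_mul _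
  refine (integral_add h1.1 (integrable_finsetSum _ fun a _ => hin a)).trans ?_
  rw [integral_finsetSum _ fun a _ => hin a]
  have h3 : ∀ a, ∫ p, ∑ b, A a b * (p.2 i a * p.2 j b) ∂innovationLaw δ (diagonal c) M V =
      ∑ b, A a b * (M i a * M j b + diagonal c i j / (δ - 2) * V a b) := by
    intro a
    rw [integral_finsetSum _ fun b _ => (h2 a b).1.const_mul _]
    exact Finset.sum_congr rfl fun b _ => by rw [integral_const_mul, (h2 a b).2]
  simp_rw [h3, h1.2]
  have h4 : (M * A * Mᵀ) i j = ∑ a, ∑ b, A a b * (M i a * M j b) := by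
    simp only [Matrix.mul_apply, Matrix.transpose_apply, Finset.sum_mul]
    rw [Finset.sum_comm]
    exact Finset.sum_congr rfl fun a _ => Finset.sum_congr rfl fun b _ => by ring
  rw [h4]
  simp only [mul_add, Finset.sum_add_distrib, mul_one, Finset.mul_sum]
  have h5 : ∀ a b, A a b * (diagonal c i j / (δ - 2) * V a b) =
      diagonal c i j / (δ - 2) * (A a b * V a b) := fun a b => by ring
  simp_rw [h5]
  ring

end InnovationLaw

/-! ### Sigma-algebras of the past -/

section Past

variable {Ω α β : Type*} {m0 : MeasurableSpace Ω} [MeasurableSpace α] [MeasurableSpace β]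
  {X : ℕ → Ω → α} {φ : ℕ → Ω → β}

theorem pastOf_le (hX : ∀ t, Measurable (X t)) (t : ℕ) : pastOf X t ≤ m0 :=
  iSup_le fun s => (hX s).comap_le

theorem measurable_pastOf (t : ℕ) : Measurable[pastOf X t] (X t) :=
  Measurable.of_comap_le (le_iSup (fun s : Fin (t + 1) =>
    MeasurableSpace.comap (X (s : ℕ)) inferInstance) (Fin.last t))

theorem pastOfAugmented_le (hX : ∀ t, Measurable (X t)) (hφ : ∀ t, Measurable (φ (t + 1))) (t : ℕ) :
    pastOfAugmented X φ t ≤ m0 :=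
  sup_le (pastOf_le hX t) (iSup_le fun s => (hφ s).comap_le)

theorem measurable_pastOfAugmented (t : ℕ) : Measurable[pastOfAugmented X φ t] (X t) :=
  (measurable_pastOf t).mono le_sup_left le_rfl

end Past

/-! ### Innovations of IW-AR(1) processes -/

section AutoregressiveChain

set_option linter.unusedSectionVars false

variable {Ω : Type*} [MeasurableSpace Ω] {μ : Measure Ω} [IsProbabilityMeasure μ] {q : ℕ}
  {n : ℝ} {S F : Matrix (Fin q) (Fin q) ℝ} {X φ : ℕ → Ω → Matrix (Fin q) (Fin q) ℝ}

/-- Brings the scale into the form of the block decomposition, with D = nS, M = F and C = n(S -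
FSF'). -/
theorem smul_iwarScale (n : ℝ) (S F : Matrix (Fin q) (Fin q) ℝ) :
    n • iwarScale S F = fromBlocks (n • S) ((n • S) * Fᵀ) (F * (n • S))
      (n • (S - F * S * Fᵀ) + F * (n • S) * Fᵀ) := by
  rw [iwarScale, fromBlocks_smul]
  simp only [Matrix.smul_mul, Matrix.mul_smul, smul_sub, sub_add_cancel]

/-- Stands in for evaluating the normalising constant: the pair has this law under a probability
measure, so the normalised measure has mass 1. -/
theorem IsIWAR.isProbabilityMeasure (h : IsIWAR μ n S F X) :
    IsProbabilityMeasure (inverseWishart (n + 2) (n • iwarScale S F)) := by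
  have h1 := (h.law_pair 0).isProbabilityMeasure_iff.1 inferInstance
  exact (Measure.isProbabilityMeasure_map_iff (Measurable.aemeasurable (by fun_prop))).1 h1

theorem IsIWAR.posDef_smul (h : IsIWAR μ n S F X) : (n • S).PosDef := h.posDef_scale.smul h.n_pos

theorem IsIWAR.isProbabilityMeasure_innovation (h : IsIWAR μ n S F X) :
    IsProbabilityMeasure (inverseWishart (n + q + 2) (n • (S - F * S * Fᵀ))) := by
  have := (inverseWishart_fromBlocks h.posDef_smul (smul_iwarScale n S F)
    h.isProbabilityMeasure).2.1
  rw [Fintype.card_fin] at this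
  convert this using 2
  ring

theorem IsIWAR.isProbabilityMeasure_marginal (h : IsIWAR μ n S F X) :
    IsProbabilityMeasure (inverseWishart (n + 2) (n • S)) :=
  (inverseWishart_fromBlocks h.posDef_smul (smul_iwarScale n S F) h.isProbabilityMeasure).1

theorem IsIWAR.isProbabilityMeasure_innovationLaw (h : IsIWAR μ n S F X) :
    IsProbabilityMeasure (innovationLaw (n + q + 2) (n • (S - F * S * Fᵀ)) F (n • S)⁻¹) :=
  _root_.isProbabilityMeasure_innovationLaw h.posDef_smul.inv h.isProbabilityMeasure_innovation

theorem IsIWAR.inverseWishart_eq_map (h : IsIWAR μ n S F X) :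
    inverseWishart (n + 2) (n • iwarScale S F) = ((inverseWishart (n + 2) (n • S)).prod
      (innovationLaw (n + q + 2) (n • (S - F * S * Fᵀ)) F (n • S)⁻¹)).map
        fun p => blockJoin p.1 p.2.2 p.2.1 := by
  have := (inverseWishart_fromBlocks h.posDef_smul (smul_iwarScale n S F)
    h.isProbabilityMeasure).2.2
  rw [Fintype.card_fin] at this
  rw [this, innovationLaw, add_right_comm n 2 (q : ℝ)]

theorem IsIWAR.hasLaw (h : IsIWAR μ n S F X) (t : ℕ) :
    HasLaw (X t) (inverseWishart (n + 2) (n • S)) μ := by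
  refine ⟨(h.measurable t).aemeasurable, ?_⟩
  have h1 := (h.law_pair t).map_eq
  have h2 := congrArg (Measure.map Prod.fst) h1
  rw [Measure.map_map measurable_fst ((h.measurable t).prodMk (h.measurable (t + 1))),
    Measure.map_map measurable_fst (by fun_prop)] at h2
  refine Eq.trans h2 ?_
  exact map_toBlocks₁₁_inverseWishart h.posDef_smul (smul_iwarScale n S F) h.isProbabilityMeasure

theorem IsIWAR.ae_posDef (h : IsIWAR μ n S F X) (t : ℕ) : ∀ᵐ ω ∂μ, (X t ω).PosDef :=
  ((h.hasLaw t).ae_iff (measurableSet_setOfPred.1 measurableSet_posDef)).2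
    (ae_posDef_inverseWishart _ _)

/-- The lower right block of `blockJoin` is `nextState`, so the block decomposition read on the
diagonal blocks is a transition driven by an independent innovation. -/
theorem IsIWAR.map_pair_eq_compProd (h : IsIWAR μ n S F X) (t : ℕ) :
    μ.map (fun ω => (X t ω, X (t + 1) ω)) = μ.map (X t) ⊗ₘ innovationKernel
      (innovationLaw (n + q + 2) (n • (S - F * S * Fᵀ)) F (n • S)⁻¹) nextState := by
  have := h.isProbabilityMeasure_innovationLaw
  have := h.isProbabilityMeasure_marginal
  rw [(h.hasLaw t).map_eq, compProd_innovationKernel _ _ measurable_nextState,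
    (h.law_pair t).map_eq, h.inverseWishart_eq_map,
    Measure.map_map (by fun_prop) measurable_blockJoin]
  rfl

/-- The new latent block and the new state, as a function of the old state and the innovations. -/
def nextAugmented (p : Matrix (Fin q) (Fin q) ℝ × Matrix (Fin q) (Fin q) ℝ ×
    Matrix (Fin q) (Fin q) ℝ) : Matrix (Fin q) (Fin q) ℝ × Matrix (Fin q) (Fin q) ℝ :=
  (p.2.2 * p.1, nextState p)

theorem measurable_nextAugmented : Measurable (nextAugmented (q := q)) := by
  have := measurable_nextState (ι := Fin q) (κ := Fin q)
  unfold nextAugmented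
  fun_prop

/-- The innovations `(Ψ, Υ)` as a function of the old state, the latent block and the new state. -/
def recoverInnovation (p : Matrix (Fin q) (Fin q) ℝ × Matrix (Fin q) (Fin q) ℝ ×
    Matrix (Fin q) (Fin q) ℝ) : Matrix (Fin q) (Fin q) ℝ × Matrix (Fin q) (Fin q) ℝ :=
  (p.2.2 - p.2.1 * p.1⁻¹ * p.1 * (p.2.1 * p.1⁻¹)ᵀ, p.2.1 * p.1⁻¹)

theorem measurable_recoverInnovation : Measurable (recoverInnovation (q := q)) := by
  unfold recoverInnovation
  fun_prop

theorem recoverInnovation_nextAugmented {A : Matrix (Fin q) (Fin q) ℝ} (hA : A.PosDef)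
    (p : Matrix (Fin q) (Fin q) ℝ × Matrix (Fin q) (Fin q) ℝ) :
    recoverInnovation (A, nextAugmented (A, p)) = p := by
  have h1 : A * A⁻¹ = 1 := mul_nonsing_inv _ ((isUnit_iff_isUnit_det A).1 hA.isUnit)
  simp only [recoverInnovation, nextAugmented, nextState, Matrix.mul_assoc p.2 A A⁻¹, h1,
    Matrix.mul_one, add_sub_cancel_right]

theorem IsAugmentedIWAR.map_eq_compProd (h : IsAugmentedIWAR μ n S F X φ) (t : ℕ) :
    μ.map (fun ω => (X t ω, (φ (t + 1) ω, X (t + 1) ω))) = μ.map (X t) ⊗ₘ innovationKernel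
      (innovationLaw (n + q + 2) (n • (S - F * S * Fᵀ)) F (n • S)⁻¹) nextAugmented := by
  have := h.isProbabilityMeasure_innovationLaw
  have := h.isProbabilityMeasure_marginal
  have hX := h.measurable
  have hφ := h.measurable_latent t
  have h1 : (fun ω => (X t ω, (φ (t + 1) ω, X (t + 1) ω))) =
      (fun Z : Matrix (Fin q ⊕ Fin q) (Fin q ⊕ Fin q) ℝ =>
        (Z.toBlocks₁₁, (Z.toBlocks₂₁, Z.toBlocks₂₂))) ∘
      fun ω => fromBlocks (X t ω) (φ (t + 1) ω)ᵀ (φ (t + 1) ω) (X (t + 1) ω) := by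
    funext ω; simp
  rw [(h.hasLaw t).map_eq, compProd_innovationKernel _ _ measurable_nextAugmented, h1,
    ← Measure.map_map (by fun_prop) (by have := hX t; have := hX (t + 1); fun_prop),
    (h.law_block t).map_eq, h.inverseWishart_eq_map,
    Measure.map_map (by fun_prop) measurable_blockJoin]
  rfl

/-- One identity serves twice: the whole space as G gives the law of the innovations, and general G
gives independence of the past. -/
theorem IsAugmentedIWAR.innovation_inter (h : IsAugmentedIWAR μ n S F X φ) (t : ℕ) {G : Set Ω}
    (hG : MeasurableSet[pastOfAugmented X φ t] G)
    {C : Set (Matrix (Fin q) (Fin q) ℝ × Matrix (Fin q) (Fin q) ℝ)} (hC : MeasurableSet C) :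
    μ (((fun ω => (innovΨ X φ t ω, innovΥ X φ t ω)) ⁻¹' C) ∩ G) =
      innovationLaw (n + q + 2) (n • (S - F * S * Fᵀ)) F (n • S)⁻¹ C * μ G := by
  have := h.isProbabilityMeasure_innovationLaw
  refine map_restrict_innovation (X := X t) (Y := fun ω => (φ (t + 1) ω, X (t + 1) ω))
    measurable_nextAugmented (pastOfAugmented_le h.measurable h.measurable_latent t)
    (measurable_pastOfAugmented t) ((h.measurable_latent t).prodMk (h.measurable (t + 1)))
    (h.map_eq_compProd t) (h.markov_augmented t) measurable_recoverInnovation ?_ hG hC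
  filter_upwards [h.ae_posDef t] with ω hω
  exact recoverInnovation_nextAugmented hω

theorem IsAugmentedIWAR.measurable_innovΥ (h : IsAugmentedIWAR μ n S F X φ) (t : ℕ) :
    Measurable (innovΥ X φ t) :=
  (h.measurable_latent t).matrix_mul (h.measurable t).matrix_inv

theorem IsAugmentedIWAR.measurable_innovΨ (h : IsAugmentedIWAR μ n S F X φ) (t : ℕ) :
    Measurable (innovΨ X φ t) :=
  (h.measurable (t + 1)).matrix_sub (((h.measurable_innovΥ t).matrix_mul
    (h.measurable t)).matrix_mul (h.measurable_innovΥ t).matrix_transpose)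

theorem IsAugmentedIWAR.map_innovation (h : IsAugmentedIWAR μ n S F X φ) (t : ℕ) :
    μ.map (fun ω => (innovΨ X φ t ω, innovΥ X φ t ω)) =
      innovationLaw (n + q + 2) (n • (S - F * S * Fᵀ)) F (n • S)⁻¹ := by
  refine Measure.ext fun C hC => ?_
  have h1 := h.innovation_inter t MeasurableSet.univ hC
  rw [Set.inter_univ, measure_univ, mul_one] at h1
  rw [Measure.map_apply ((h.measurable_innovΨ t).prodMk (h.measurable_innovΥ t)) hC, h1]

theorem IsAugmentedIWAR.hasLaw_innovΨ (h : IsAugmentedIWAR μ n S F X φ) (t : ℕ) :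
    HasLaw (innovΨ X φ t) (inverseWishart (n + q + 2) (n • (S - F * S * Fᵀ))) μ := by
  refine ⟨(h.measurable_innovΨ t).aemeasurable, ?_⟩
  have h1 := congrArg (Measure.map Prod.fst) (h.map_innovation t)
  rw [Measure.map_map measurable_fst ((h.measurable_innovΨ t).prodMk (h.measurable_innovΥ t)),
    map_fst_innovationLaw h.posDef_smul.inv h.isProbabilityMeasure_innovation] at h1
  exact h1

/-- The joint law is already disintegrated along Ψ, and regular conditional laws are almost surely
unique. The kernel is the matrix normal law only at positive definite arguments, which Ψ almost
surely provides. -/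
theorem IsAugmentedIWAR.condDistrib_innovΥ (h : IsAugmentedIWAR μ n S F X φ) (t : ℕ) :
    ∀ᵐ ψ ∂(μ.map (innovΨ X φ t)), condDistrib (innovΥ X φ t) (innovΨ X φ t) μ ψ =
      matrixNormal F ψ (n • S)⁻¹ := by
  have hK := isMarkovKernel_matrixNormalKernel F h.posDef_smul.inv
  have h1 := condDistrib_ae_eq_of_measure_eq_compProd (innovΨ X φ t)
    (h.measurable_innovΥ t).aemeasurable (κ := matrixNormalKernel F (n • S)⁻¹)
    (by rw [h.map_innovation t, (h.hasLaw_innovΨ t).map_eq]; rfl)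
  have h2 := ae_posDef_inverseWishart (n + q + 2) (n • (S - F * S * Fᵀ))
  rw [← (h.hasLaw_innovΨ t).map_eq] at h2
  filter_upwards [h1, h2] with ψ hψ hpd
  rw [hψ, matrixNormalKernel_apply _ _ hpd]

theorem IsAugmentedIWAR.indep_innovation (h : IsAugmentedIWAR μ n S F X φ) (t : ℕ) :
    Indep (MeasurableSpace.comap (fun ω => (innovΥ X φ t ω, innovΨ X φ t ω)) inferInstance)
      (pastOfAugmented X φ t) μ := by
  rw [Indep_iff]
  rintro _ G ⟨C, hC, rfl⟩ hG
  -- The joint law lists Ψ before Υ, whereas independence is stated for the pair in the other order.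
  have hC' : MeasurableSet (Prod.swap ⁻¹' C) := measurable_swap hC
  have h1 := h.innovation_inter t hG hC'
  have h2 := h.innovation_inter t MeasurableSet.univ hC'
  rw [Set.inter_univ, measure_univ, mul_one] at h2
  rw [← h2] at h1
  exact h1

theorem IsAugmentedIWAR.latent_eq (h : IsAugmentedIWAR μ n S F X φ) (t : ℕ) :
    ∀ᵐ ω ∂μ, φ (t + 1) ω = innovΥ X φ t ω * X t ω := by
  filter_upwards [h.ae_posDef t] with ω hω
  rw [innovΥ, Matrix.mul_assoc, nonsing_inv_mul _ ((isUnit_iff_isUnit_det _).1 hω.isUnit),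
    Matrix.mul_one]

end AutoregressiveChain

end

noncomputable section

/-! ### Rotations of IW-AR(1) processes -/

section Rotation

set_option linter.unusedSectionVars false

variable {Ω : Type*} [MeasurableSpace Ω] {μ : Measure Ω} [IsProbabilityMeasure μ] {q : ℕ}
  {n : ℝ} {S F E : Matrix (Fin q) (Fin q) ℝ} {X φ : ℕ → Ω → Matrix (Fin q) (Fin q) ℝ}

/-- Conjugation by an orthogonal matrix. -/
def rotationMeasurableEquiv (E : Matrix (Fin q) (Fin q) ℝ) (hE : Eᵀ * E = 1) :
    Matrix (Fin q) (Fin q) ℝ ≃ᵐ Matrix (Fin q) (Fin q) ℝ where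
  toFun X := Eᵀ * X * E
  invFun X := E * X * Eᵀ
  left_inv X := by
    have hE' : E * Eᵀ = 1 := mul_eq_one_comm.1 hE
    simp only [← Matrix.mul_assoc, hE', Matrix.one_mul]
    rw [Matrix.mul_assoc, hE', Matrix.mul_one]
  right_inv X := by
    simp only [← Matrix.mul_assoc, hE, Matrix.one_mul]
    rw [Matrix.mul_assoc, hE, Matrix.mul_one]
  measurable_toFun := by simp only [Equiv.coe_fn_mk]; fun_prop
  measurable_invFun := by simp only [Equiv.coe_fn_symm_mk]; fun_prop

/-- A measurable bijection generates the same sigma-algebra, which lets the Markov conditions pass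
to the rotated process unchanged. -/
theorem comap_rotate (hE : Eᵀ * E = 1) (Z : ℕ → Ω → Matrix (Fin q) (Fin q) ℝ) (t : ℕ) :
    MeasurableSpace.comap (rotate E Z t) inferInstance =
      MeasurableSpace.comap (Z t) inferInstance := by
  have h1 : rotate E Z t = rotationMeasurableEquiv E hE ∘ Z t := rfl
  rw [h1, ← MeasurableSpace.comap_comp]
  congr 1
  exact (rotationMeasurableEquiv E hE).measurableEmbedding.comap_eq

theorem pastOf_rotate (hE : Eᵀ * E = 1) (X : ℕ → Ω → Matrix (Fin q) (Fin q) ℝ) (t : ℕ) :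
    pastOf (rotate E X) t = pastOf X t :=
  iSup_congr fun s => comap_rotate hE X s

theorem pastOfAugmented_rotate (hE : Eᵀ * E = 1) (X φ : ℕ → Ω → Matrix (Fin q) (Fin q) ℝ) (t : ℕ) :
    pastOfAugmented (rotate E X) (rotate E φ) t = pastOfAugmented X φ t := by
  rw [pastOfAugmented, pastOf_rotate hE]
  exact congrArg _ (iSup_congr fun s => comap_rotate hE φ (s + 1))

theorem fromBlocks_rotate (E A B C D : Matrix (Fin q) (Fin q) ℝ) :
    fromBlocks Eᵀ 0 0 Eᵀ * fromBlocks A B C D * (fromBlocks Eᵀ 0 0 Eᵀ)ᵀ =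
      fromBlocks (Eᵀ * A * E) (Eᵀ * B * E) (Eᵀ * C * E) (Eᵀ * D * E) := by
  simp [fromBlocks_transpose, fromBlocks_multiply]

/-- Rotating both diagonal blocks and the latent block at once is congruence by the orthogonal
matrix diag(E', E'), and EE' = 1 can be inserted between the factors of F S and S F'. -/
theorem map_rotate_inverseWishart (hE : Eᵀ * E = 1) (δ n : ℝ) (S F : Matrix (Fin q) (Fin q) ℝ) :
    (inverseWishart δ (n • iwarScale S F)).map
        (fun Z => fromBlocks Eᵀ 0 0 Eᵀ * Z * (fromBlocks Eᵀ 0 0 Eᵀ)ᵀ) =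
      inverseWishart δ (n • iwarScale (Eᵀ * S * E) (Eᵀ * F * E)) := by
  have hE' : E * Eᵀ = 1 := mul_eq_one_comm.1 hE
  have hT : (fromBlocks Eᵀ 0 0 Eᵀ : Matrix (Fin q ⊕ Fin q) (Fin q ⊕ Fin q) ℝ)ᵀ *
      fromBlocks Eᵀ 0 0 Eᵀ = 1 := by
    simp [fromBlocks_transpose, fromBlocks_multiply, hE']
  rw [map_congruence_inverseWishart _ _ hT]
  congr 1
  rw [Matrix.mul_smul, Matrix.smul_mul, iwarScale, fromBlocks_rotate, iwarScale]
  have h1 : Eᵀ * (S * Fᵀ) * E = Eᵀ * S * E * (Eᵀ * F * E)ᵀ := by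
    calc _ = Eᵀ * S * (E * Eᵀ) * Fᵀ * E := by rw [hE', Matrix.mul_one]; simp only [Matrix.mul_assoc]
      _ = _ := by simp only [transpose_mul, transpose_transpose, Matrix.mul_assoc]
  have h2 : Eᵀ * (F * S) * E = Eᵀ * F * E * (Eᵀ * S * E) := by
    calc _ = Eᵀ * F * (E * Eᵀ) * S * E := by rw [hE', Matrix.mul_one]; simp only [Matrix.mul_assoc]
      _ = _ := by simp only [Matrix.mul_assoc]
  rw [h1, h2]

theorem posDef_rotate (hE : Eᵀ * E = 1) {A : Matrix (Fin q) (Fin q) ℝ} (hA : A.PosDef) :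
    (Eᵀ * A * E).PosDef := by
  have := (IsUnit.of_mul_eq_one_right _ hE).posDef_star_left_conjugate_iff (x := A)
  rw [star_eq_conjTranspose, conjTranspose_eq_transpose_of_trivial] at this
  exact this.2 hA

theorem IsIWAR.rotate (hE : Eᵀ * E = 1) (h : IsIWAR μ n S F X) :
    IsIWAR μ n (Eᵀ * S * E) (Eᵀ * F * E) (rotate E X) where
  n_pos := h.n_pos
  posDef_scale := posDef_rotate hE h.posDef_scale
  posDef_innovation := by
    have hE' : E * Eᵀ = 1 := mul_eq_one_comm.1 hE
    have h1 := posDef_rotate hE h.posDef_innovation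
    have h2 : Eᵀ * (S - F * S * Fᵀ) * E =
        Eᵀ * S * E - Eᵀ * F * E * (Eᵀ * S * E) * (Eᵀ * F * E)ᵀ := by
      have h3 : Eᵀ * (F * S * Fᵀ) * E = Eᵀ * F * E * (Eᵀ * S * E) * (Eᵀ * F * E)ᵀ := by
        calc _ = Eᵀ * F * (E * Eᵀ) * S * (E * Eᵀ) * Fᵀ * E := by
              rw [hE', Matrix.mul_one, Matrix.mul_one]; simp only [Matrix.mul_assoc]
          _ = _ := by simp only [transpose_mul, transpose_transpose, Matrix.mul_assoc]
      rw [Matrix.mul_sub, Matrix.sub_mul, h3]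
    rwa [h2] at h1
  measurable t := (rotationMeasurableEquiv E hE).measurable.comp (h.measurable t)
  law_pair t := by
    have hm := (rotationMeasurableEquiv E hE).measurable
    have hX := h.measurable
    refine ⟨((hm.comp (hX t)).prodMk (hm.comp (hX (t + 1)))).aemeasurable, ?_⟩
    have h1 : (fun ω => (_root_.rotate E X t ω, _root_.rotate E X (t + 1) ω)) =
        Prod.map (rotationMeasurableEquiv E hE) (rotationMeasurableEquiv E hE) ∘
          fun ω => (X t ω, X (t + 1) ω) := rfl
    rw [h1, ← Measure.map_map (hm.prodMap hm) ((hX t).prodMk (hX (t + 1))), (h.law_pair t).map_eq,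
      ← map_rotate_inverseWishart hE, Measure.map_map (hm.prodMap hm) (by fun_prop),
      Measure.map_map (by fun_prop) (by fun_prop)]
    congr 1
    funext Z
    simp only [Function.comp_apply, Prod.map_apply]
    conv_rhs => rw [← fromBlocks_toBlocks Z, fromBlocks_rotate, toBlocks_fromBlocks₁₁,
      toBlocks_fromBlocks₂₂]
    rfl
  markov t B hB := by
    -- An event for the rotated state is an event for the original state, with the preimage of B
    -- under the rotation.
    rw [pastOf_rotate hE, comap_rotate hE]
    exact h.markov t _ ((rotationMeasurableEquiv E hE).measurable hB)

theorem IsAugmentedIWAR.rotate (hE : Eᵀ * E = 1) (h : IsAugmentedIWAR μ n S F X φ) :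
    IsAugmentedIWAR μ n (Eᵀ * S * E) (Eᵀ * F * E) (rotate E X) (rotate E φ) where
  toIsIWAR := h.toIsIWAR.rotate hE
  measurable_latent t := (rotationMeasurableEquiv E hE).measurable.comp (h.measurable_latent t)
  law_block t := by
    have hX := h.measurable t
    have hX' := h.measurable (t + 1)
    have hφ := h.measurable_latent t
    have h1 : (fun ω => fromBlocks (_root_.rotate E X t ω) (_root_.rotate E φ (t + 1) ω)ᵀ
        (_root_.rotate E φ (t + 1) ω) (_root_.rotate E X (t + 1) ω)) =
        (fun Z => fromBlocks Eᵀ 0 0 Eᵀ * Z * (fromBlocks Eᵀ 0 0 Eᵀ)ᵀ) ∘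
          fun ω => fromBlocks (X t ω) (φ (t + 1) ω)ᵀ (φ (t + 1) ω) (X (t + 1) ω) := by
      funext ω
      rw [Function.comp_apply, fromBlocks_rotate]
      simp only [_root_.rotate, transpose_mul, transpose_transpose, Matrix.mul_assoc]
    rw [h1, ← map_rotate_inverseWishart hE]
    exact ⟨Measurable.aemeasurable (by fun_prop), by
      rw [← Measure.map_map (by fun_prop) (by fun_prop), (h.law_block t).map_eq]⟩
  markov_augmented t B hB := by
    have hm := (rotationMeasurableEquiv E hE).measurable
    rw [pastOfAugmented_rotate hE, comap_rotate hE]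
    exact h.markov_augmented t _ ((hm.prodMap hm) hB)

/-- Holds everywhere rather than almost surely: the rule for inverting a product is valid also when
the state is singular. -/
theorem innovΥ_rotate (hE : Eᵀ * E = 1) (X φ : ℕ → Ω → Matrix (Fin q) (Fin q) ℝ) :
    innovΥ (rotate E X) (rotate E φ) = rotate E (innovΥ X φ) := by
  have hE' : E * Eᵀ = 1 := mul_eq_one_comm.1 hE
  funext t ω
  simp only [innovΥ, rotate]
  rw [Matrix.mul_inv_rev, Matrix.mul_inv_rev, inv_eq_left_inv hE, inv_eq_left_inv hE']
  calc _ = Eᵀ * φ (t + 1) ω * (E * Eᵀ) * ((X t ω)⁻¹ * E) := by simp only [Matrix.mul_assoc]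
    _ = _ := by rw [hE', Matrix.mul_one]; simp only [Matrix.mul_assoc]

theorem innovΨ_rotate (hE : Eᵀ * E = 1) (X φ : ℕ → Ω → Matrix (Fin q) (Fin q) ℝ) :
    innovΨ (rotate E X) (rotate E φ) = rotate E (innovΨ X φ) := by
  have hE' : E * Eᵀ = 1 := mul_eq_one_comm.1 hE
  funext t ω
  have h : innovΨ (rotate E X) (rotate E φ) t ω = rotate E X (t + 1) ω -
      rotate E (innovΥ X φ) t ω * rotate E X t ω * (rotate E (innovΥ X φ) t ω)ᵀ := by
    rw [← innovΥ_rotate hE]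
    rfl
  rw [h]
  change Eᵀ * X (t + 1) ω * E - Eᵀ * innovΥ X φ t ω * E * (Eᵀ * X t ω * E) *
      (Eᵀ * innovΥ X φ t ω * E)ᵀ =
    Eᵀ * (X (t + 1) ω - innovΥ X φ t ω * X t ω * (innovΥ X φ t ω)ᵀ) * E
  rw [Matrix.mul_sub, Matrix.sub_mul]
  congr 1
  simp only [transpose_mul, transpose_transpose]
  calc _ = Eᵀ * innovΥ X φ t ω * (E * Eᵀ) * X t ω * (E * Eᵀ) * (innovΥ X φ t ω)ᵀ * E := by
        simp only [Matrix.mul_assoc]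
    _ = _ := by rw [hE', Matrix.mul_one, Matrix.mul_one]; simp only [Matrix.mul_assoc]

end Rotation

/-! ### Conditional means of IW-AR(1) processes with diagonal parameters -/

section ConditionalMean

set_option linter.unusedSectionVars false

variable {Ω : Type*} {m m0 : MeasurableSpace Ω} {μ : Measure Ω} [IsProbabilityMeasure μ] {q : ℕ}
  {n : ℝ} {ξ ρ : Fin q → ℝ} {X : ℕ → Ω → Matrix (Fin q) (Fin q) ℝ}

/-- The one step prediction `R A R + n / (n + q) (1 + tr (A (nQ)⁻¹)) Q (I - R²)`. -/
def iwarMean (n : ℝ) (ξ ρ : Fin q → ℝ) (A : Matrix (Fin q) (Fin q) ℝ) :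
    Matrix (Fin q) (Fin q) ℝ :=
  diagonal ρ * A * diagonal ρ + (n / (n + q) * (1 + ∑ k, (n * ξ k)⁻¹ * A k k)) •
    (diagonal ξ * (1 - diagonal ρ ^ 2))

theorem diagonal_mul_one_sub_sq (ξ ρ : Fin q → ℝ) :
    diagonal ξ * (1 - diagonal ρ ^ 2) = diagonal fun i => ξ i * (1 - ρ i ^ 2) := by
  rw [diagonal_pow, ← diagonal_one, diagonal_sub, diagonal_mul_diagonal]
  rfl

theorem diagonal_innovation_scale (ξ ρ : Fin q → ℝ) :
    diagonal ξ - diagonal ρ * diagonal ξ * (diagonal ρ)ᵀ =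
      diagonal ξ * (1 - diagonal ρ ^ 2) := by
  rw [diagonal_mul_one_sub_sq, diagonal_transpose, diagonal_mul_diagonal, diagonal_mul_diagonal,
    diagonal_sub]
  congr 1
  funext i
  ring

theorem iwarMean_apply (n : ℝ) (ξ ρ : Fin q → ℝ) (A : Matrix (Fin q) (Fin q) ℝ) (i j : Fin q) :
    iwarMean n ξ ρ A i j = ρ i * ρ j * A i j + n / (n + q) * (1 + ∑ k, (n * ξ k)⁻¹ * A k k) *
      diagonal (fun i => ξ i * (1 - ρ i ^ 2)) i j := by
  rw [iwarMean, diagonal_mul_one_sub_sq, Matrix.add_apply, mul_diagonal, diagonal_mul,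
    Matrix.smul_apply, smul_eq_mul]
  ring

theorem IsIWAR.integrable_entry (h : IsIWAR μ n (diagonal ξ) (diagonal ρ) X) (t : ℕ)
    (i j : Fin q) : Integrable (fun ω => X t ω i j) μ := by
  have h1 := h.hasLaw t
  have h2 := h.isProbabilityMeasure_marginal
  have hs : n • diagonal ξ = diagonal (n • ξ) := (diagonal_smul n ξ).symm
  have hpos : ∀ k, 0 < (n • ξ) k := fun k => by
    have := h.posDef_smul.diag_pos (i := k)
    rwa [hs, diagonal_apply_eq] at this
  rw [hs] at h1 h2
  have h3 := (inverseWishart_diagonal_mean (by have := h.n_pos; linarith) hpos h2 i j).1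
  rw [← h1.map_eq] at h3
  exact h3.comp_aemeasurable h1.aemeasurable

/-- The sigma-algebra is left general so that the prediction formula applies both to conditioning on
the current state and to conditioning on the whole past. -/
theorem IsIWAR.condExp_entry (h : IsIWAR μ n (diagonal ξ) (diagonal ρ) X) (t : ℕ)
    (hm : m ≤ m0) (hX : Measurable[m] (X t))
    (hM : ∀ B, MeasurableSet B → μ⟦X (t + 1) ⁻¹' B | m⟧ =ᵐ[μ]
      μ⟦X (t + 1) ⁻¹' B | MeasurableSpace.comap (X t) inferInstance⟧) (i j : Fin q) :
    μ[fun ω => X (t + 1) ω i j | m] =ᵐ[μ] fun ω => iwarMean n ξ ρ (X t ω) i j := by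
  have hτ := h.isProbabilityMeasure_innovationLaw
  have hg := measurable_nextState (ι := Fin q) (κ := Fin q)
  have hκ := isMarkovKernel_innovationKernel (innovationLaw (n + q + 2)
    (n • (diagonal ξ - diagonal ρ * diagonal ξ * (diagonal ρ)ᵀ)) (diagonal ρ)
    (n • diagonal ξ)⁻¹) hg
  have hn := h.n_pos
  have hent := measurable_matrix_entry i j
  refine (condExp_comp_eq_integral_of_markov hm hX (h.measurable (t + 1))
    (h.map_pair_eq_compProd t) hM (f := fun Y => Y i j) hent
    (h.integrable_entry (t + 1) i j)).trans ?_
  refine Filter.Eventually.of_forall fun ω => ?_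
  have hs : n • diagonal ξ = diagonal (n • ξ) := (diagonal_smul n ξ).symm
  have hC : n • (diagonal ξ - diagonal ρ * diagonal ξ * (diagonal ρ)ᵀ) =
      diagonal fun i => n * (ξ i * (1 - ρ i ^ 2)) := by
    rw [diagonal_innovation_scale, diagonal_mul_one_sub_sq, ← diagonal_smul]
    rfl
  have hprob := h.isProbabilityMeasure_innovation
  have hξ : ∀ k, 0 < ξ k := fun k => by
    have := h.posDef_scale.diag_pos (i := k)
    rwa [diagonal_apply_eq] at this
  have hc : ∀ k, 0 < n * (ξ k * (1 - ρ k ^ 2)) := fun k => by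
    have := (h.posDef_innovation.smul hn).diag_pos (i := k)
    rwa [hC, diagonal_apply_eq] at this
  have hV : (n • diagonal ξ)⁻¹ = diagonal fun k => (n * ξ k)⁻¹ := by
    refine inv_eq_right_inv ?_
    rw [hs, diagonal_mul_diagonal, ← diagonal_one]
    congr 1
    funext k
    exact mul_inv_cancel₀ (mul_pos hn (hξ k)).ne'
  simp only
  rw [innovationKernel_apply _ hg, integral_map (Measurable.aemeasurable (by fun_prop))
    hent.aestronglyMeasurable]
  have hVp := h.posDef_smul.inv
  rw [hC] at hprob ⊢
  -- The innovation Ψ has n + q + 2 degrees of freedom, so its mean divides by n + q; with the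
  -- factor n in its scale this is the constant n/(n + q).
  rw [integral_nextState (by have : (0 : ℝ) ≤ q := Nat.cast_nonneg q; linarith) hc hVp hprob, hV,
    iwarMean_apply]
  have hsum : ∑ a, ∑ b, X t ω a b * diagonal (fun k => (n * ξ k)⁻¹) a b =
      ∑ k, (n * ξ k)⁻¹ * X t ω k k := by
    refine Finset.sum_congr rfl fun a _ => ?_
    rw [Finset.sum_eq_single a]
    · rw [diagonal_apply_eq, mul_comm]
    · intro b _ hb
      rw [diagonal_apply_ne _ (Ne.symm hb), mul_zero]
    · simp
  have hdiag : diagonal (fun i => n * (ξ i * (1 - ρ i ^ 2))) i j =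
      n * diagonal (fun i => ξ i * (1 - ρ i ^ 2)) i j := by
    by_cases hij : i = j
    · subst hij; simp
    · simp [hij]
  rw [hsum, hdiag, diagonal_transpose, mul_diagonal, diagonal_mul,
    show n + (q : ℝ) + 2 - 2 = n + q by ring]
  ring

theorem IsIWAR.condExp_entry_comap (h : IsIWAR μ n (diagonal ξ) (diagonal ρ) X) (t : ℕ)
    (i j : Fin q) :
    μ[fun ω => X (t + 1) ω i j | MeasurableSpace.comap (X t) inferInstance] =ᵐ[μ]
      fun ω => iwarMean n ξ ρ (X t ω) i j :=
  h.condExp_entry t (h.measurable t).comap_le (comap_measurable _)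
    (fun _ _ => Filter.EventuallyEq.rfl) i j

theorem IsIWAR.condExp_entry_pastOf (h : IsIWAR μ n (diagonal ξ) (diagonal ρ) X) (t : ℕ)
    (i j : Fin q) :
    μ[fun ω => X (t + 1) ω i j | pastOf X t] =ᵐ[μ] fun ω => iwarMean n ξ ρ (X t ω) i j :=
  h.condExp_entry t (pastOf_le h.measurable t) (measurable_pastOf t) (h.markov t) i j

/-- The prediction g is a version of the conditional expectation, so it inherits integrability and
the mean of f, and conditioning it again changes nothing. -/
theorem integral_and_condExp_sub_of_condExp_eq {f g : Ω → ℝ} (hm : m ≤ m0) (hf : Integrable f μ)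
    (hfg : μ[f | m] =ᵐ[μ] g) :
    Integrable (fun ω => f ω - g ω) μ ∧ ∫ ω, (f ω - g ω) ∂μ = 0 ∧
      μ[fun ω => f ω - g ω | m] =ᵐ[μ] 0 := by
  have hg : Integrable g μ := integrable_condExp.congr hfg
  refine ⟨hf.sub hg, ?_, ?_⟩
  · rw [integral_sub hf hg, ← integral_congr_ae hfg, integral_condExp hm, sub_self]
  · have h1 : μ[g | m] =ᵐ[μ] μ[f | m] :=
      (condExp_congr_ae hfg.symm).trans (condExp_condExp_of_le le_rfl hm)
    filter_upwards [condExp_sub hf hg m, h1] with ω h2 h3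
    change (μ[f - g | m]) ω = 0
    rw [h2, Pi.sub_apply, h3, sub_self]

end ConditionalMean

end

/-! ### The main theorem, by passage to the eigenbasis E. -/

theorem theorem4 {Ω : Type*} [MeasurableSpace Ω] (μ : Measure Ω) [IsProbabilityMeasure μ]
    {q : ℕ} (n : ℝ) (S F E : Matrix (Fin q) (Fin q) ℝ) (ρ ξ : Fin q → ℝ)
    (X : ℕ → Ω → Matrix (Fin q) (Fin q) ℝ)
    (hE : E ∈ Matrix.orthogonalGroup (Fin q) ℝ)
    (hξ : ∀ i, 0 < ξ i)
    (hF : F = E * Matrix.diagonal ρ * Eᵀ)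
    (hS : S = E * Matrix.diagonal ξ * Eᵀ)
    (hX : IsIWAR μ n S F X) :
    -- the rotated sequence is an IW-AR(1) process
    IsIWAR μ n (Matrix.diagonal ξ) (Matrix.diagonal ρ) (rotate E X) ∧
    -- marginal distribution
    (∀ t, HasLaw (rotate E X t) (inverseWishart (n + 2) (n • Matrix.diagonal ξ)) μ) ∧
    -- innovations
    (∀ φ : ℕ → Ω → Matrix (Fin q) (Fin q) ℝ, IsAugmentedIWAR μ n S F X φ →
      IsAugmentedIWAR μ n (Matrix.diagonal ξ) (Matrix.diagonal ρ) (rotate E X) (rotate E φ) ∧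
      ∀ t,
        (∀ᵐ ω ∂μ, rotate E φ (t + 1) ω = rotate E (innovΥ X φ) t ω * rotate E X t ω) ∧
        (∀ ω, rotate E X (t + 1) ω = rotate E (innovΨ X φ) t ω +
          rotate E (innovΥ X φ) t ω * rotate E X t ω * (rotate E (innovΥ X φ) t ω)ᵀ) ∧
        Measurable (rotate E (innovΥ X φ) t) ∧
        Measurable (rotate E (innovΨ X φ) t) ∧
        HasLaw (rotate E (innovΨ X φ) t) (inverseWishart (n + q + 2)
          (n • (Matrix.diagonal ξ * (1 - Matrix.diagonal ρ ^ 2)))) μ ∧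
        (∀ᵐ ψ ∂(μ.map (rotate E (innovΨ X φ) t)),
          condDistrib (rotate E (innovΥ X φ) t) (rotate E (innovΨ X φ) t) μ ψ =
            matrixNormal (Matrix.diagonal ρ) ψ (n • Matrix.diagonal ξ)⁻¹) ∧
        Indep (MeasurableSpace.comap
            (fun ω => (rotate E (innovΥ X φ) t ω, rotate E (innovΨ X φ) t ω)) inferInstance)
          (pastOfAugmented (rotate E X) (rotate E φ) t) μ) ∧
    -- conditional mean
    (∀ t i j, Integrable (fun ω => rotate E X (t + 1) ω i j) μ ∧
      μ[fun ω => rotate E X (t + 1) ω i j |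
          MeasurableSpace.comap (rotate E X t) inferInstance] =ᵐ[μ]
        fun ω => ((Matrix.diagonal ρ * rotate E X t ω * Matrix.diagonal ρ +
          (n / (n + q) * (1 + ∑ k, (n * ξ k)⁻¹ * rotate E X t ω k k)) •
            (Matrix.diagonal ξ * (1 - Matrix.diagonal ρ ^ 2)) : Matrix (Fin q) (Fin q) ℝ)) i j) ∧
    -- autoregressions of the individual entries
    (∃ v : ℕ → Fin q → Fin q → Ω → ℝ,
      (∀ t i j, Integrable (v (t + 1) i j) μ ∧ ∫ ω, v (t + 1) i j ω ∂μ = 0 ∧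
        μ[v (t + 1) i j | pastOf (rotate E X) t] =ᵐ[μ] 0) ∧
      (∀ t j ω, rotate E X (t + 1) ω j j = ρ j ^ 2 * rotate E X t ω j j +
        n / (n + q) * (1 + ∑ k, (n * ξ k)⁻¹ * rotate E X t ω k k) * (1 - ρ j ^ 2) * ξ j +
          v (t + 1) j j ω) ∧
      (∀ t i j, i ≠ j → ∀ ω, rotate E X (t + 1) ω i j =
        ρ i * ρ j * rotate E X t ω i j + v (t + 1) i j ω)) := by
  have hE1 : Eᵀ * E = 1 := (Matrix.mem_orthogonalGroup_iff' (Fin q) ℝ).1 hE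
  have hSE : Eᵀ * S * E = diagonal ξ := by
    rw [hS]
    exact (rotationMeasurableEquiv E hE1).right_inv _
  have hFE : Eᵀ * F * E = diagonal ρ := by
    rw [hF]
    exact (rotationMeasurableEquiv E hE1).right_inv _
  have hR : IsIWAR μ n (diagonal ξ) (diagonal ρ) (rotate E X) := by
    rw [← hSE, ← hFE]
    exact hX.rotate hE1
  refine ⟨hR, hR.hasLaw, fun φ hφ => ?_, fun t i j =>
    ⟨hR.integrable_entry (t + 1) i j, hR.condExp_entry_comap t i j⟩, ?_⟩
  · have hA : IsAugmentedIWAR μ n (diagonal ξ) (diagonal ρ) (rotate E X) (rotate E φ) := by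
      rw [← hSE, ← hFE]
      exact hφ.rotate hE1
    -- Rotated innovations are the innovations of the rotated process, and Q(I - R²) is its
    -- innovation scale Q - RQR'; the general results for augmented processes then apply.
    rw [← innovΥ_rotate hE1, ← innovΨ_rotate hE1, ← diagonal_innovation_scale]
    exact ⟨hA, fun t => ⟨hA.latent_eq t, fun ω => (sub_add_cancel _ _).symm,
      hA.measurable_innovΥ t, hA.measurable_innovΨ t, hA.hasLaw_innovΨ t, hA.condDistrib_innovΥ t,
      hA.indep_innovation t⟩⟩
  -- The noise is the deviation from the one step prediction. At time 0 the truncated subtraction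
  -- gives a meaningless value, but only times t + 1 are used.
  · refine ⟨fun t i j ω => rotate E X t ω i j - iwarMean n ξ ρ (rotate E X (t - 1) ω) i j,
      fun t i j => ?_, fun t j ω => ?_, fun t i j hij ω => ?_⟩
    · simp only [Nat.add_sub_cancel]
      exact integral_and_condExp_sub_of_condExp_eq (pastOf_le hR.measurable t)
        (hR.integrable_entry (t + 1) i j) (hR.condExp_entry_pastOf t i j)
    · change _ = _ + (rotate E X (t + 1) ω j j - iwarMean n ξ ρ (rotate E X t ω) j j)
      rw [iwarMean_apply, diagonal_apply_eq]
      ring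
    · change _ = _ + (rotate E X (t + 1) ω i j - iwarMean n ξ ρ (rotate E X t ω) i j)
      -- Off the diagonal the forcing term vanishes, leaving a pure autoregression.
      rw [iwarMean_apply, diagonal_apply_ne _ hij]
      ring
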